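/- Let $a<b$ be real numbers and let $f:(a,b)\times\mathbb R\to\mathbb R$ be any function. For $v\in BV(a,b)$, i.e. $v\in L^1(a,b)$ whose distributional derivative $Dv$ is a finite signed Borel measure on $(a,b)$, write $Dv=D^av\,dx+D^sv$ for the Lebesgue decomposition of $Dv$ with respect to Lebesgue measure, $\frac{D^sv}{|D^sv|}$ for the density of $D^sv$ with respect to its total variation $|D^sv|$, and $v(x_0^\pm)$ for the one-sided (essential) traces of $v$. A function $u\in BV(a,b)$ is a *bounded variation solution* of $$-\Big(\frac{u'}{\sqrt{1+(u')^2}}\Big)'=f(x,u),\qquad a<x<b, \tag{E}$$ if $f(\cdot,u(\cdot))\in L^1(a,b)$ and $$\int_a^b \frac{D^au\,D^a\phi}{\sqrt{1+(D^au)^2}}\,dx+\int_a^b\frac{D^su}{|D^su|}\,D^s\phi=\int_a^b f(x,u(x))\,\phi(x)\,dx$$ for all $\phi\in BV(a,b)$ such that $|D^s\phi|$ is absolutely continuous with respect to $|D^su|$ and $\phi(a^+)=\phi(b^-)=0$. As usual, functions are identified when they agree almost everywhere; concavity, convexity and the values of $u'$ below refer to a suitable representative of $u$. The space $W^{2,1}_{\rm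 loc}[a,b)$ consists of the functions in $W^{2,1}(a,d)$ for all $d\in(a,b)$; $W^{2,1}_{\rm loc}(a,b]$ and $W^{2,1}_{\rm loc}(a,b)$ are defined likewise. The symbols $u'(x_0^\pm)$ stand for one-sided limits of $u'$. **Theorem.** Let $u$ be a bounded variation solution of (E). Then the following hold. (i) If $f(x,u(x))\ge 0$ for almost all $x\in(a,b)$, then $u$ is concave and either $u\in W^{2,1}(a,b)$; or $u\in W^{2,1}_{\rm loc}[a,b)\cap W^{1,1}(a,b)$ and $u'(b^-)=-\infty$; or $u\in W^{2,1}_{\rm loc}(a,b]\cap W^{1,1}(a,b)$ and $u'(a^+)=+\infty$; or $u\in W^{2,1}_{\rm loc}(a,b)\cap W^{1,1}(a,b)$, $u'(a^+)=+\infty$ and $u'(b^-)=-\infty$. In all cases $u$ satisfies (E) for almost all $x\in(a,b)$. (ii) If $f(x,u(x))\le 0$ for almost all $x\in(a,b)$, then $u$ is convex and either $u\in W^{2,1}(a,b)$; or $u\in W^{2,1}_{\rm loc}[a,b)\cap W^{1,1}(a,b)$ and $u'(b^-)=+\infty$; or $u\in W^{2,1}_{\rm loc}(a,b]\cap W^{1,1}(a,b)$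 and $u'(a^+)=-\infty$; or $u\in W^{2,1}_{\rm loc}(a,b)\cap W^{1,1}(a,b)$, $u'(a^+)=-\infty$ and $u'(b^-)=+\infty$. In all cases $u$ satisfies (E) for almost all $x\in(a,b)$. (iii) If there is $c\in(a,b)$ such that $f(x,u(x))\ge 0$ for almost all $x\in(a,c)$ and $f(x,u(x))\le 0$ for almost all $x\in(c,b)$, then $u|_{(a,c)}$ is concave, $u|_{(c,b)}$ is convex, and either $u\in W^{2,1}_{\rm loc}(a,b)\cap W^{1,1}(a,b)$; or $u|_{(a,c)}\in W^{2,1}_{\rm loc}(a,c)\cap W^{1,1}(a,c)$, $u|_{(c,b)}\in W^{2,1}_{\rm loc}(c,b)\cap W^{1,1}(c,b)$, $u(c^-)\ge u(c^+)$ and $u'(c^-)=-\infty=u'(c^+)$. Moreover, in case $u(c^-)>u(c^+)$, $$D^su=(u(c^+)-u(c^-))\,\delta_c, \tag{1}$$ where $\delta_c$ is the Dirac measure concentrated at $c$. In any circumstances $u$ satisfies (E) for almost all $x\in(a,b)$. (iv) If there is $c\in(a,b)$ such that $f(x,u(x))\le 0$ for almost all $x\in(a,c)$ and $f(x,u(x))\ge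 0$ for almost all $x\in(c,b)$, then $u|_{(a,c)}$ is convex, $u|_{(c,b)}$ is concave, and either $u\in W^{2,1}_{\rm loc}(a,b)\cap W^{1,1}(a,b)$; or $u|_{(a,c)}\in W^{2,1}_{\rm loc}(a,c)\cap W^{1,1}(a,c)$, $u|_{(c,b)}\in W^{2,1}_{\rm loc}(c,b)\cap W^{1,1}(c,b)$, $u(c^-)\le u(c^+)$ and $u'(c^-)=+\infty=u'(c^+)$. Moreover, in case $u(c^-)<u(c^+)$, (1) holds. In any circumstances $u$ satisfies (E) for almost all $x\in(a,b)$. -/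

import Mathlib

open MeasureTheory Set Filter
open scoped Topology ContDiff

noncomputable section

namespace Curvature

/-- Test functions on `(a, b)`: smooth functions with compact support contained in `(a, b)`. -/
structure IsTestFunction (a b : ℝ) (η : ℝ → ℝ) : Prop where
  contDiff : ContDiff ℝ ∞ η
  hasCompactSupport : HasCompactSupport η
  tsupport_subset : tsupport η ⊆ Ioo a b

/-- `u ∈ BV(a, b)` with distributional derivative `Du = μ`: the function `u` is in `L¹(a, b)` and
`μ` is the (unique) finite signed Borel measure carried by `(a, b)` with
`∫ u η' dx = - ∫ η dμ` for all test functions `η`. -/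
structure HasBVDeriv (a b : ℝ) (u : ℝ → ℝ) (μ : SignedMeasure ℝ) : Prop where
  integrableOn : IntegrableOn u (Ioo a b)
  carried : μ.totalVariation (Ioo a b)ᶜ = 0
  integral_eq : ∀ η : ℝ → ℝ, IsTestFunction a b η →
    ∫ x in Ioo a b, u x * deriv η x = - ∫ᵛ x, η x ∂•μ

/-- The density `Dᵃv` of the absolutely continuous part of `Dv = μ`. -/
def acDensity (μ : SignedMeasure ℝ) : ℝ → ℝ := μ.rnDeriv volume

/-- The singular part `Dˢv` of `Dv = μ`. -/
def singPart (μ : SignedMeasure ℝ) : SignedMeasure ℝ := μ.singularPart volume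

/-- The density `σ / |σ|` of a signed measure `σ` with respect to its total variation `|σ|`. -/
def polarDensity (σ : SignedMeasure ℝ) : ℝ → ℝ := σ.rnDeriv σ.totalVariation

/-- `L = u(x₀⁺)`: the right trace of `u` at `x₀` (essential right limit). -/
def HasRightTrace (u : ℝ → ℝ) (x₀ L : ℝ) : Prop :=
  Tendsto u (𝓝[>] x₀ ⊓ ae volume) (𝓝 L)

/-- `L = u(x₀⁻)`: the left trace of `u` at `x₀` (essential left limit). -/
def HasLeftTrace (u : ℝ → ℝ) (x₀ L : ℝ) : Prop :=
  Tendsto u (𝓝[<] x₀ ⊓ ae volume) (𝓝 L)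

/-- `u` is a bounded variation solution of `-(u' / √(1 + u'²))' = f(x, u)` on `(a, b)`. Here `μ`
is `Du`, and `ν` is `Dφ` for the test function `φ ∈ BV(a, b)`. -/
def IsBVSolution (f : ℝ → ℝ → ℝ) (a b : ℝ) (u : ℝ → ℝ) : Prop :=
  IntegrableOn (fun x => f x (u x)) (Ioo a b) ∧
  ∃ μ : SignedMeasure ℝ, HasBVDeriv a b u μ ∧
    ∀ (φ : ℝ → ℝ) (ν : SignedMeasure ℝ), HasBVDeriv a b φ ν →
      (singPart ν).totalVariation ≪ (singPart μ).totalVariation →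
      HasRightTrace φ a 0 → HasLeftTrace φ b 0 →
      (∫ x in Ioo a b, acDensity μ x * acDensity ν x / √(1 + acDensity μ x ^ 2))
        + (∫ᵛ x, polarDensity (singPart μ) x ∂•(singPart ν))
        = ∫ x in Ioo a b, f x (u x) * φ x

/-- `g` is a weak derivative of `u` on `(a, b)`. Used only for `u` and `g` in `L¹(a, b)`. -/
def HasWeakDeriv (a b : ℝ) (u g : ℝ → ℝ) : Prop :=
  ∀ η : ℝ → ℝ, IsTestFunction a b η →
    ∫ x in Ioo a b, u x * deriv η x = - ∫ x in Ioo a b, g x * η x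

/-- `u ∈ W^{1,1}(a, b)`. -/
def MemW11 (a b : ℝ) (u : ℝ → ℝ) : Prop :=
  IntegrableOn u (Ioo a b) ∧
    ∃ g : ℝ → ℝ, IntegrableOn g (Ioo a b) ∧ HasWeakDeriv a b u g

/-- `u ∈ W^{2,1}(a, b)`. -/
def MemW21 (a b : ℝ) (u : ℝ → ℝ) : Prop :=
  IntegrableOn u (Ioo a b) ∧
    ∃ g : ℝ → ℝ, MemW11 a b g ∧ HasWeakDeriv a b u g

/-- `u ∈ W^{2,1}_loc(a, b)`. -/
def MemW21locOO (a b : ℝ) (u : ℝ → ℝ) : Prop :=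
  ∀ c d : ℝ, a < c → c < d → d < b → MemW21 c d u

/-- `u ∈ W^{2,1}_loc[a, b)`. -/
def MemW21locCO (a b : ℝ) (u : ℝ → ℝ) : Prop :=
  ∀ d : ℝ, a < d → d < b → MemW21 a d u

/-- `u ∈ W^{2,1}_loc(a, b]`. -/
def MemW21locOC (a b : ℝ) (u : ℝ → ℝ) : Prop :=
  ∀ c : ℝ, a < c → c < b → MemW21 c b u

/-- `v` satisfies `-(v' / √(1 + v'²))' = f(x, v)` at the point `x`, in the classical sense:
`v` is differentiable near `x`, and `v' / √(1 + v'²)` is differentiable at `x`. -/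
def SatisfiesEqAt (f : ℝ → ℝ → ℝ) (v : ℝ → ℝ) (x : ℝ) : Prop :=
  (∀ᶠ y in 𝓝 x, DifferentiableAt ℝ v y) ∧
    HasDerivAt (fun y => deriv v y / √(1 + deriv v y ^ 2)) (-f x (v x)) x

/-- `v` satisfies the equation almost everywhere in `(a, b)`. -/
def SatisfiesEqAE (f : ℝ → ℝ → ℝ) (a b : ℝ) (v : ℝ → ℝ) : Prop :=
  ∀ᵐ x ∂(volume.restrict (Ioo a b)), SatisfiesEqAt f v x

/-- `v ∈ BV(a, b)` and `Dˢv = (Lp - Lm) δ_c`; below, `Lp = v(c⁺)` and `Lm = v(c⁻)`. -/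
def SingPartIsJump (a b : ℝ) (v : ℝ → ℝ) (c Lm Lp : ℝ) : Prop :=
  ∃ μ : SignedMeasure ℝ, HasBVDeriv a b v μ ∧
    singPart μ = (Lp - Lm) • (Measure.dirac c).toSignedMeasure

end Curvature

end

/-! The weak equation is tested with a function built from the solution itself. Let m be Lebesgue
measure on (a, b) plus |Dˢu|, let F be Dᵃu/√(1 + (Dᵃu)²) Lebesgue-a.e. and Dˢu/|Dˢu| |Dˢu|-a.e., and
let H(x) be the integral of f(t, u(t)) over (x, b). If ∫ k dm = 0, then φ(x) = ∫_{(-∞, x]} k dm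
vanishes at both ends, and Fubini turns the equation into ∫ (F - H) k dm = 0. Taking for k the
function F - H minus its mean forces F - H to be constant m-a.e. (`exists_flux`). Hence F has a
continuous representative Ψ, the flux, with Ψ' = -f(x, u) a.e., |Ψ| < 1 Lebesgue-a.e. and |Ψ| = 1
|Dˢu|-a.e.

A sign of f(x, u) makes Ψ monotone. A monotone function that is a.e. less than 1 in modulus can
reach ±1 only at the ends of its interval, so Dˢu vanishes in (i) and (ii) and can only charge {c}
in (iii) and (iv), where the jump has the sign of Ψ(c) (`singPart_eq_smul_dirac`). Elsewhere u' =
`invFlux` ∘ Ψ, with `invFlux` increasing, C¹ on (-1, 1) and infinite at ±1. Its monotonicity gives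
concavity and convexity, its local Lipschitz bound gives absolute continuity of u' and thus W^{2,1}
regularity, and its blow-up gives the infinite slopes. -/

noncomputable section

namespace Curvature

/-! ### Signed measures with densities and polar decomposition -/

/-- Integration against a signed measure given by a density. -/
theorem integral_withDensityᵥ_eq {α : Type*} [MeasurableSpace α] {m : Measure α} [IsFiniteMeasure m]
    {k f : α → ℝ} {C : ℝ} (hk : Integrable k m) (hf : Measurable f) (hC : ∀ᵐ x ∂m, |f x| ≤ C) :
    ∫ᵛ x, f x ∂•(m.withDensityᵥ k) = ∫ x, f x * k x ∂m := by
  have hfin1 := isFiniteMeasure_withDensity_ofReal hk.2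
  have hfin2 := isFiniteMeasure_withDensity_ofReal hk.neg.2
  -- Each of the positive parts of k and -k defines a finite positive measure; the claim is proved
  -- for such measures and then subtracted.
  have key : ∀ g : α → ℝ, Integrable g m →
      ∀ _ : IsFiniteMeasure (m.withDensity fun x => ENNReal.ofReal (g x)),
      (m.withDensity fun x => ENNReal.ofReal (g x)).toSignedMeasure.Integrable f ∧
      ∫ᵛ x, f x ∂•(m.withDensity fun x => ENNReal.ofReal (g x)).toSignedMeasure
        = ∫ x, (max (g x) 0) * f x ∂m := by
    intro g hg hfin
    have h1 : (ContinuousLinearMap.lsmul ℝ ℝ : ℝ →L[ℝ] ℝ →L[ℝ] ℝ)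
        = (ContinuousLinearMap.lsmul ℝ ℝ : ℝ →L[ℝ] ℝ →L[ℝ] ℝ).flip := by
      ext; simp
    constructor
    · rw [VectorMeasure.Integrable, Measure.variation_toSignedMeasure]
      refine ⟨hf.aestronglyMeasurable, HasFiniteIntegral.of_bounded (C := C) ?_⟩
      exact (withDensity_absolutelyContinuous _ _).ae_le hC
    · rw [h1, VectorMeasure.integral_toSignedMeasure,
        integral_withDensity_eq_integral_toReal_smul₀ hg.1.aemeasurable.ennreal_ofReal
        (by simp)]
      simp [ENNReal.toReal_ofReal']
  obtain ⟨i1, e1⟩ := key k hk hfin1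
  obtain ⟨i2, e2⟩ := key (fun x => - k x) hk.neg hfin2
  rw [withDensityᵥ_eq_withDensity_pos_part_sub_withDensity_neg_part hk,
    VectorMeasure.integral_sub_vectorMeasure i1 i2, e1, e2, ← integral_sub]
  · congr 1
    ext x
    rcases le_total (k x) 0 with h | h <;> simp [h] <;> ring
  · exact hk.pos_part.mul_bdd hf.aestronglyMeasurable hC
  · exact hk.neg.pos_part.mul_bdd hf.aestronglyMeasurable hC

theorem withDensityᵥ_polarDensity (s : SignedMeasure ℝ) :
    s.totalVariation.withDensityᵥ (polarDensity s) = s := by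
  refine SignedMeasure.withDensityᵥ_rnDeriv_eq s _ ?_
  rw [SignedMeasure.absolutelyContinuous_ennreal_iff]
  simp [VectorMeasure.ennrealToMeasure_toENNRealVectorMeasure, Measure.AbsolutelyContinuous.rfl]

theorem integrable_polarDensity (s : SignedMeasure ℝ) :
    Integrable (polarDensity s) s.totalVariation := SignedMeasure.integrable_rnDeriv _ _

/-- The total variation of p|s| is |p||s|, and p|s| is s itself, so |p| and 1 are both densities of
|s| with respect to |s|; densities are unique a.e. -/
theorem abs_polarDensity (s : SignedMeasure ℝ) :
    ∀ᵐ x ∂s.totalVariation, |polarDensity s x| = 1 := by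
  have h := Measure.variation_withDensityᵥ (integrable_polarDensity s)
  rw [withDensityᵥ_polarDensity, ← SignedMeasure.totalVariation_eq_variation] at h
  have h2 : s.totalVariation.withDensity (fun x => ‖polarDensity s x‖ₑ)
      = s.totalVariation.withDensity 1 := by
    rw [← h, withDensity_one]
  have := (withDensity_eq_iff (by exact (integrable_polarDensity s).1.enorm) (by fun_prop)
    (integrable_polarDensity s).2.ne).1 h2
  filter_upwards [this] with x hx
  have : ‖polarDensity s x‖ = 1 := by
    have := congrArg ENNReal.toReal hx
    simpa using this
  simpa using this

theorem totalVariation_withDensityᵥ {m : Measure ℝ} {k : ℝ → ℝ} (hk : Integrable k m) :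
    SignedMeasure.totalVariation (m.withDensityᵥ k) = m.withDensity fun x => ‖k x‖ₑ := by
  rw [SignedMeasure.totalVariation_eq_variation, Measure.variation_withDensityᵥ hk]

theorem totalVariation_withDensityᵥ_ac {m : Measure ℝ} {k : ℝ → ℝ} (hk : Integrable k m) :
    SignedMeasure.totalVariation (m.withDensityᵥ k) ≪ m := by
  rw [totalVariation_withDensityᵥ hk]
  exact withDensity_absolutelyContinuous _ _

/-! ### Distribution functions as test functions in BV -/

/-- Fubini's theorem for a cumulative integral. -/
theorem integral_mul_cumulative {m : Measure ℝ} [IsFiniteMeasure m] {k h : ℝ → ℝ} {s : Set ℝ}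
    (hk : Integrable k m) (hh : IntegrableOn h s) :
    ∫ x in s, h x * ∫ y in Iic x, k y ∂m
      = ∫ y, (∫ x in s, (Ici y).indicator h x) * k y ∂m := by
  have hT : MeasurableSet {p : ℝ × ℝ | p.2 ≤ p.1} := measurableSet_le measurable_snd measurable_fst
  have hint : Integrable (Function.uncurry fun x y => {p : ℝ × ℝ | p.2 ≤ p.1}.indicator
      (fun p => h p.1 * k p.2) (x, y)) ((volume.restrict s).prod m) :=
    (hh.mul_prod hk).indicator hT
  have := integral_integral_swap hint
  calc _ = ∫ x in s, ∫ y, {p : ℝ × ℝ | p.2 ≤ p.1}.indicator (fun p => h p.1 * k p.2) (x, y) ∂m := by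
        congr 1; ext x
        rw [← integral_const_mul, ← integral_indicator measurableSet_Iic]
        congr 1
    _ = _ := this
    _ = _ := by
        congr 1; ext y
        rw [← integral_mul_const]
        congr 1; ext x
        by_cases hxy : y ≤ x <;> simp [indicator, hxy]

theorem IsTestFunction.continuous_deriv {a b : ℝ} {η : ℝ → ℝ} (hη : IsTestFunction a b η) :
    Continuous (deriv η) := hη.contDiff.continuous_deriv (by simp)

theorem IsTestFunction.eq_zero {a b : ℝ} {η : ℝ → ℝ} (hη : IsTestFunction a b η) {x : ℝ}
    (hx : x ∉ Ioo a b) : η x = 0 :=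
  image_eq_zero_of_notMem_tsupport fun h => hx (hη.tsupport_subset h)

theorem IsTestFunction.integrable_deriv {a b : ℝ} {η : ℝ → ℝ} (hη : IsTestFunction a b η) :
    Integrable (deriv η) := hη.continuous_deriv.integrable_of_hasCompactSupport
      hη.hasCompactSupport.deriv

theorem IsTestFunction.bounded {a b : ℝ} {η : ℝ → ℝ} (hη : IsTestFunction a b η) :
    ∃ C, ∀ x, |η x| ≤ C :=
  hη.hasCompactSupport.exists_bound_of_continuous hη.contDiff.continuous

theorem IsTestFunction.integral_deriv_Ici {a b : ℝ} {η : ℝ → ℝ} (hη : IsTestFunction a b η)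
    {y : ℝ} (hy : y ∈ Ioo a b) :
    ∫ x in Ioo a b, (Ici y).indicator (deriv η) x = - η y := by
  rw [setIntegral_indicator measurableSet_Ici]
  have h1 : Ioo a b ∩ Ici y = Ico y b := by
    ext x; simp only [mem_inter_iff, mem_Ioo, mem_Ici, mem_Ico]
    constructor
    · rintro ⟨⟨_, h⟩, h'⟩; exact ⟨h', h⟩
    · rintro ⟨h, h'⟩; exact ⟨⟨hy.1.trans_le h, h'⟩, h⟩
  rw [h1, integral_Ico_eq_integral_Ioo, ← integral_Ioc_eq_integral_Ioo,
    ← intervalIntegral.integral_of_le hy.2.le,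
    intervalIntegral.integral_deriv_eq_sub
      (fun x _ => (hη.contDiff.differentiable (by simp)).differentiableAt)
      (hη.continuous_deriv.intervalIntegrable _ _), hη.eq_zero (x := b) (by simp)]
  ring

theorem stronglyMeasurable_cumulative {m : Measure ℝ} [IsFiniteMeasure m] {k : ℝ → ℝ}
    (hk : StronglyMeasurable k) : StronglyMeasurable fun x => ∫ y in Iic x, k y ∂m := by
  have hT : MeasurableSet {p : ℝ × ℝ | p.2 ≤ p.1} := measurableSet_le measurable_snd measurable_fst
  have : StronglyMeasurable ({p : ℝ × ℝ | p.2 ≤ p.1}.indicator fun p => k p.2) :=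
    (hk.comp_measurable measurable_snd).indicator hT
  have := this.integral_prod_right' (ν := m)
  convert this using 2 with x
  rw [← integral_indicator measurableSet_Iic]
  congr 1

theorem integrableOn_cumulative {m : Measure ℝ} [IsFiniteMeasure m] {k : ℝ → ℝ} {a b : ℝ}
    (hk : StronglyMeasurable k) (hki : Integrable k m) :
    IntegrableOn (fun x => ∫ y in Iic x, k y ∂m) (Ioo a b) := by
  refine Integrable.of_bound (stronglyMeasurable_cumulative hk).aestronglyMeasurable
    (∫ y, ‖k y‖ ∂m) (ae_of_all _ fun x => ?_)
  exact (norm_integral_le_integral_norm _).trans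
    (setIntegral_le_integral hki.norm (ae_of_all _ fun _ => norm_nonneg _))

/-- A measure with a density on `(a, b)` is the derivative of its distribution function. -/
theorem hasBVDeriv_cumulative {m : Measure ℝ} [IsFiniteMeasure m] {k : ℝ → ℝ} {a b : ℝ}
    (hm : m (Ioo a b)ᶜ = 0) (hk : StronglyMeasurable k) (hki : Integrable k m) :
    HasBVDeriv a b (fun x => ∫ y in Iic x, k y ∂m) (m.withDensityᵥ k) where
  integrableOn := integrableOn_cumulative hk hki
  carried := totalVariation_withDensityᵥ_ac hki hm
  integral_eq η hη := by
    obtain ⟨C, hC⟩ := hη.bounded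
    rw [integral_withDensityᵥ_eq hki hη.contDiff.continuous.measurable (ae_of_all _ hC),
      ← integral_neg]
    simp_rw [mul_comm _ (deriv η _)]
    rw [integral_mul_cumulative hki hη.integrable_deriv.integrableOn]
    refine integral_congr_ae ?_
    have : ∀ᵐ y ∂m, y ∈ Ioo a b := by rw [ae_iff]; exact hm
    filter_upwards [this] with y hy
    rw [hη.integral_deriv_Ici hy]; ring

theorem tendsto_cumulative_right {m : Measure ℝ} {k : ℝ → ℝ} (hki : Integrable k m) (a : ℝ) :
    Tendsto (fun x => ∫ y in Iic x, k y ∂m) (𝓝[>] a) (𝓝 (∫ y in Iic a, k y ∂m)) := by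
  simp_rw [← integral_indicator measurableSet_Iic]
  refine tendsto_integral_filter_of_dominated_convergence (fun y => ‖k y‖)
    (Eventually.of_forall fun x => (hki.indicator measurableSet_Iic).1)
    (Eventually.of_forall fun x => ae_of_all _ fun y => norm_indicator_le_norm_self _ _)
    hki.norm (ae_of_all _ fun y => tendsto_const_nhds.congr' ?_)
  rcases le_or_gt y a with h | h
  · filter_upwards [self_mem_nhdsWithin] with x hx
    simp [indicator, h, h.trans (le_of_lt hx)]
  · filter_upwards [Ioo_mem_nhdsGT h] with x hx
    simp [indicator, not_le.2 h, not_le.2 hx.2]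

/-- Dominated convergence as on the right, except that a possible atom at b is missed: the limit is
over the open half-line. -/
theorem tendsto_cumulative_left {m : Measure ℝ} {k : ℝ → ℝ} (hki : Integrable k m) (b : ℝ) :
    Tendsto (fun x => ∫ y in Iic x, k y ∂m) (𝓝[<] b) (𝓝 (∫ y in Iio b, k y ∂m)) := by
  simp_rw [← integral_indicator measurableSet_Iic, ← integral_indicator measurableSet_Iio]
  refine tendsto_integral_filter_of_dominated_convergence (fun y => ‖k y‖)
    (Eventually.of_forall fun x => (hki.indicator measurableSet_Iic).1)
    (Eventually.of_forall fun x => ae_of_all _ fun y => norm_indicator_le_norm_self _ _)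
    hki.norm (ae_of_all _ fun y => tendsto_const_nhds.congr' ?_)
  rcases lt_or_ge y b with h | h
  · filter_upwards [Ioo_mem_nhdsLT h] with x hx
    simp [indicator, h, hx.1.le]
  · filter_upwards [self_mem_nhdsWithin] with x hx
    have hx : x < b := hx
    simp [indicator, not_lt.2 h, not_le.2 (hx.trans_le h)]

theorem hasRightTrace_cumulative {m : Measure ℝ} {k : ℝ → ℝ} {a b : ℝ}
    (hm : m (Ioo a b)ᶜ = 0) (hki : Integrable k m) :
    HasRightTrace (fun x => ∫ y in Iic x, k y ∂m) a 0 := by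
  have h0 : ∫ y in Iic a, k y ∂m = 0 := by
    refine setIntegral_measure_zero _ (measure_mono_null (fun x hx => ?_) hm)
    simp only [mem_compl_iff, mem_Ioo, not_and, not_lt]
    intro h; exact absurd hx (not_le.2 h)
  exact (h0 ▸ tendsto_cumulative_right hki a).mono_left inf_le_left

/-- The zero mean of k is exactly the boundary condition at b; at a it is automatic. -/
theorem hasLeftTrace_cumulative {m : Measure ℝ} {k : ℝ → ℝ} {a b : ℝ}
    (hm : m (Ioo a b)ᶜ = 0) (hki : Integrable k m) (hk0 : ∫ y, k y ∂m = 0) :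
    HasLeftTrace (fun x => ∫ y in Iic x, k y ∂m) b 0 := by
  have h0 : ∫ y in Iio b, k y ∂m = 0 := by
    rw [setIntegral_eq_integral_of_ae_compl_eq_zero, hk0]
    have : ∀ᵐ y ∂m, y ∈ Ioo a b := by rw [ae_iff]; exact hm
    filter_upwards [this] with y hy h
    exact absurd hy.2 h
  exact (h0 ▸ tendsto_cumulative_left hki b).mono_left inf_le_left

/-! ### Lebesgue decomposition of the test measures -/

theorem singPart_mutuallySingular (μ : SignedMeasure ℝ) :
    (singPart μ).totalVariation ⟂ₘ volume := by
  have := SignedMeasure.mutuallySingular_singularPart μ volume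
  rwa [SignedMeasure.mutuallySingular_ennreal_iff,
    VectorMeasure.ennrealToMeasure_toENNRealVectorMeasure] at this

theorem withDensityᵥ_add_restrict {σ : Measure ℝ} {k : ℝ → ℝ} {s : Set ℝ} (hs : MeasurableSet s)
    (hki : Integrable k (volume.restrict s + σ)) :
    (volume.restrict s + σ).withDensityᵥ k
      = σ.withDensityᵥ k + (volume : Measure ℝ).withDensityᵥ (s.indicator k) := by
  have h1 : Integrable k (volume.restrict s) := hki.left_of_add_measure
  have h2 : Integrable k σ := hki.right_of_add_measure
  have h1' : Integrable (s.indicator k) := (integrable_indicator_iff hs).2 h1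
  ext t ht
  rw [withDensityᵥ_apply hki ht, _root_.add_apply, withDensityᵥ_apply h2 ht,
    withDensityᵥ_apply h1' ht, Measure.restrict_add, integral_add_measure h1.restrict h2.restrict,
    integral_indicator hs, add_comm, Measure.restrict_restrict hs, Measure.restrict_restrict ht,
    inter_comm]

theorem mutuallySingular_withDensityᵥ {σ : Measure ℝ} {k : ℝ → ℝ} (hσ : σ ⟂ₘ volume)
    (hki : Integrable k σ) :
    σ.withDensityᵥ k ⟂ᵥ (volume : Measure ℝ).toENNRealVectorMeasure := by
  rw [SignedMeasure.mutuallySingular_ennreal_iff,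
    VectorMeasure.ennrealToMeasure_toENNRealVectorMeasure]
  exact hσ.mono_ac (totalVariation_withDensityᵥ_ac hki) Measure.AbsolutelyContinuous.rfl

/-- Uniqueness of the Lebesgue decomposition. With σ = |Dˢu| it shows that the test function is
admissible, since its singular part is kσ ≪ σ. -/
theorem singPart_withDensityᵥ {σ : Measure ℝ} {k : ℝ → ℝ} {s : Set ℝ} (hs : MeasurableSet s)
    (hσ : σ ⟂ₘ volume) (hki : Integrable k (volume.restrict s + σ)) :
    singPart ((volume.restrict s + σ).withDensityᵥ k) = σ.withDensityᵥ k :=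
  (SignedMeasure.eq_singularPart _ _ (mutuallySingular_withDensityᵥ hσ hki.right_of_add_measure)
    (withDensityᵥ_add_restrict hs hki)).symm

theorem acDensity_withDensityᵥ {σ : Measure ℝ} {k : ℝ → ℝ} {s : Set ℝ} (hs : MeasurableSet s)
    (hσ : σ ⟂ₘ volume) (hki : Integrable k (volume.restrict s + σ)) :
    acDensity ((volume.restrict s + σ).withDensityᵥ k) =ᵐ[volume.restrict s] k := by
  have := SignedMeasure.eq_rnDeriv _ _ ((integrable_indicator_iff hs).2 hki.left_of_add_measure)
    (mutuallySingular_withDensityᵥ hσ hki.right_of_add_measure) (withDensityᵥ_add_restrict hs hki)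
  filter_upwards [ae_restrict_of_ae this, ae_restrict_mem hs] with x hx hxs
  rw [acDensity, ← hx, indicator_of_mem hxs]

theorem totalVariation_singPart_le (μ : SignedMeasure ℝ) :
    (singPart μ).totalVariation ≤ μ.totalVariation := by
  rw [singPart, SignedMeasure.singularPart_totalVariation, SignedMeasure.totalVariation]
  exact add_le_add (Measure.singularPart_le _ _) (Measure.singularPart_le _ _)

/-! ### The continuous flux -/

theorem abs_div_sqrt_one_add_sq_lt (t : ℝ) : |t / √(1 + t ^ 2)| < 1 := by
  have h : 0 < √(1 + t ^ 2) := Real.sqrt_pos.2 (by positivity)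
  rw [abs_div, abs_of_pos h, div_lt_one h]
  exact Real.lt_sqrt_of_sq_lt (by rw [sq_abs]; linarith)

/-- Write A for the mean. Since q - A has integral zero, the hypothesis also says ∫ (q - A)² = 0. -/
theorem ae_eq_const_of_integral_mul_eq_zero {m : Measure ℝ} [IsFiniteMeasure m] {q : ℝ → ℝ}
    (hq : Integrable q m) (hq2 : Integrable (fun x => (q x - ⨍ y, q y ∂m) ^ 2) m)
    (h : ∫ x, q x * (q x - ⨍ y, q y ∂m) ∂m = 0)
    (hi : Integrable (fun x => q x * (q x - ⨍ y, q y ∂m)) m) :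
    q =ᵐ[m] fun _ => ⨍ y, q y ∂m := by
  set A := ⨍ y, q y ∂m
  have h0 : ∫ x, (q x - A) ^ 2 ∂m = 0 := by
    have e : ∀ x, (q x - A) ^ 2 = q x * (q x - A) - A * (q x - A) := fun x => by ring
    have hz : ∫ x, (q x - A) ∂m = 0 := integral_sub_average m q
    simp_rw [e]
    have hqA : Integrable (fun x => q x - A) m := hq.sub (integrable_const _)
    rw [integral_sub hi (hqA.const_mul _), h, integral_const_mul, hz]
    simp
  have := (integral_eq_zero_iff_of_nonneg (fun x => sq_nonneg _) hq2).1 h0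
  filter_upwards [this] with x hx
  have : q x - A = 0 := by simpa using hx
  linarith

/-- A bounded variation solution has a continuous flux, which is given by `Dᵃu / √(1 + |Dᵃu|²)`
almost everywhere and by `Dˢu / |Dˢu|` at `|Dˢu|`-almost every point. -/
theorem exists_flux {f : ℝ → ℝ → ℝ} {a b : ℝ} {u : ℝ → ℝ} (hu : IsBVSolution f a b u) :
    ∃ μ : SignedMeasure ℝ, HasBVDeriv a b u μ ∧ ∃ C : ℝ,
      (∀ᵐ x ∂(volume.restrict (Ioo a b)), acDensity μ x / √(1 + acDensity μ x ^ 2)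
        = C + ∫ t in x..b, (Ioo a b).indicator (fun t => f t (u t)) t) ∧
      (∀ᵐ x ∂(singPart μ).totalVariation, polarDensity (singPart μ) x
        = C + ∫ t in x..b, (Ioo a b).indicator (fun t => f t (u t)) t) := by
  obtain ⟨hint, μ, hμ, hsol⟩ := hu
  refine ⟨μ, hμ, ?_⟩
  set h : ℝ → ℝ := fun t => f t (u t)
  set h₀ := (Ioo a b).indicator h
  have hh₀ : Integrable h₀ := (integrable_indicator_iff measurableSet_Ioo).2 hint
  set H : ℝ → ℝ := fun x => ∫ t in x..b, h₀ t
  have hHc : Continuous H := by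
    have : H = fun x => - ∫ t in b..x, h₀ t := by
      ext x; exact intervalIntegral.integral_symm _ _
    rw [this]
    exact (intervalIntegral.continuous_primitive (fun _ _ => hh₀.intervalIntegrable) b).neg
  have hHb : ∀ x, |H x| ≤ ∫ t, ‖h₀ t‖ := fun x =>
    intervalIntegral.norm_integral_le_integral_norm_uIoc.trans
      (setIntegral_le_integral hh₀.norm (ae_of_all _ fun _ => norm_nonneg _))
  have hH : ∀ y ∈ Ioo a b, ∫ x in Ioo a b, (Ici y).indicator h x = H y := by
    intro y hy
    rw [← integral_indicator measurableSet_Ioo]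
    simp only [H]
    rw [intervalIntegral.integral_of_le hy.2.le, integral_Ioc_eq_integral_Ioo,
      ← integral_Ico_eq_integral_Ioo, ← integral_indicator measurableSet_Ico]
    congr 1
    ext x
    simp only [h₀, indicator, mem_Ioo, mem_Ici, mem_Ico]
    split_ifs <;> simp_all
  set σ := (singPart μ).totalVariation
  set p := polarDensity (singPart μ)
  set ψ : ℝ → ℝ := fun x => acDensity μ x / √(1 + acDensity μ x ^ 2)
  have hA : Measurable (acDensity μ) := SignedMeasure.measurable_rnDeriv _ _
  have hψ : Measurable ψ := by fun_prop
  have hp : Measurable p := SignedMeasure.measurable_rnDeriv _ _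
  have hσ : σ ⟂ₘ volume := singPart_mutuallySingular μ
  -- S is σ-null with Lebesgue-null complement, so one function F can carry the two kinds of flux,
  -- each on its own set.
  obtain ⟨S, hS, hS1, hS2⟩ := id hσ
  classical
  set F : ℝ → ℝ := S.piecewise ψ p
  have hF : Measurable F := hψ.piecewise hS hp
  have hF1 : ∀ᵐ x ∂(volume.restrict (Ioo a b)), F x = ψ x := by
    have : ∀ᵐ x ∂(volume : Measure ℝ), x ∈ S := by rw [ae_iff]; exact hS2
    filter_upwards [ae_restrict_of_ae this] with x hx
    exact piecewise_eq_of_mem _ _ _ hx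
  have hF2 : ∀ᵐ x ∂σ, F x = p x := by
    have : ∀ᵐ x ∂σ, x ∉ S := by rw [ae_iff]; simpa using hS1
    filter_upwards [this] with x hx
    exact piecewise_eq_of_notMem _ _ _ hx
  have hp1 : ∀ᵐ x ∂σ, |p x| = 1 := abs_polarDensity _
  set m : Measure ℝ := volume.restrict (Ioo a b) + σ
  have hFb : ∀ᵐ x ∂m, |F x| ≤ 1 := by
    rw [ae_add_measure_iff]
    constructor
    · filter_upwards [hF1] with x hx
      rw [hx]; exact (abs_div_sqrt_one_add_sq_lt _).le
    · filter_upwards [hF2, hp1] with x hx hx'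
      rw [hx, hx']
  have hm : m (Ioo a b)ᶜ = 0 := by
    have : σ (Ioo a b)ᶜ = 0 :=
      le_antisymm ((totalVariation_singPart_le μ _).trans_eq hμ.carried) (zero_le)
    simp [m, this, Measure.restrict_apply measurableSet_Ioo.compl]
  have hmI : ∀ᵐ y ∂m, y ∈ Ioo a b := by rw [ae_iff]; exact hm
  set q : ℝ → ℝ := fun x => F x - H x
  set A := ⨍ y, q y ∂m
  -- The density of Dφ: the defect F - H itself, corrected to have mean zero.
  set k : ℝ → ℝ := fun x => q x - A
  have hqm : Measurable q := hF.sub hHc.measurable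
  have hkm : Measurable k := hqm.sub_const _
  have hqb : ∀ᵐ x ∂m, |q x| ≤ 1 + ∫ t, ‖h₀ t‖ := by
    filter_upwards [hFb] with x hx
    exact (abs_sub _ _).trans (add_le_add hx (hHb x))
  have hqi : Integrable q m := Integrable.of_bound hqm.aestronglyMeasurable _ hqb
  have hki : Integrable k m := hqi.sub (integrable_const _)
  have hqk : Integrable (fun x => q x * k x) m :=
    hki.bdd_mul hqm.aestronglyMeasurable hqb
  have hFk : Integrable (fun x => F x * k x) m := hki.bdd_mul hF.aestronglyMeasurable hFb
  have hHk : Integrable (fun x => H x * k x) m :=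
    hki.bdd_mul hHc.aestronglyMeasurable (ae_of_all _ hHb)
  have hk0 : ∫ y, k y ∂m = 0 := integral_sub_average m q
  have key := hsol _ _ (hasBVDeriv_cumulative hm hkm.stronglyMeasurable hki)
    (by rw [singPart_withDensityᵥ measurableSet_Ioo hσ hki]
        exact totalVariation_withDensityᵥ_ac hki.right_of_add_measure)
    (hasRightTrace_cumulative hm hki) (hasLeftTrace_cumulative hm hki hk0)
  have e1 : ∫ x in Ioo a b, acDensity μ x * acDensity (m.withDensityᵥ k) x /
      √(1 + acDensity μ x ^ 2) = ∫ x in Ioo a b, F x * k x := by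
    refine integral_congr_ae ?_
    filter_upwards [hF1, acDensity_withDensityᵥ measurableSet_Ioo hσ hki] with x h1 h2
    rw [h1, h2]; ring
  have e2 : ∫ᵛ x, p x ∂•(singPart (m.withDensityᵥ k)) = ∫ x, F x * k x ∂σ := by
    rw [singPart_withDensityᵥ measurableSet_Ioo hσ hki,
      integral_withDensityᵥ_eq hki.right_of_add_measure hp (hp1.mono fun x hx => hx.le)]
    refine integral_congr_ae ?_
    filter_upwards [hF2] with x h1
    rw [h1]
  have e3 : ∫ x in Ioo a b, h x * ∫ y in Iic x, k y ∂m = ∫ x, H x * k x ∂m := by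
    rw [integral_mul_cumulative hki hint]
    refine integral_congr_ae ?_
    filter_upwards [hmI] with x hx
    rw [hH x hx]
  rw [e1, e2, e3, ← integral_add_measure hFk.left_of_add_measure hFk.right_of_add_measure] at key
  have hz : ∫ x, q x * k x ∂m = 0 := by
    have : ∀ x, q x * k x = F x * k x - H x * k x := fun x => by simp only [q]; ring
    simp_rw [this]
    rw [integral_sub hFk hHk, key, sub_self]
  have hkk : Integrable (fun x => (q x - A) ^ 2) m := by
    have : (fun x => (q x - A) ^ 2) = fun x => q x * k x - A * k x := by
      ext x; simp only [k]; ring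
    rw [this]; exact hqk.sub (hki.const_mul _)
  have hfin := ae_eq_const_of_integral_mul_eq_zero hqi hkk hz hqk
  rw [EventuallyEq, ae_add_measure_iff] at hfin
  refine ⟨A, ?_, ?_⟩
  · filter_upwards [hfin.1, hF1] with x h1 h2
    change F x - H x = A at h1
    change ψ x = A + H x
    linarith
  · filter_upwards [hfin.2, hF2] with x h1 h2
    change F x - H x = A at h1
    change p x = A + H x
    linarith

/-! ### Du Bois-Reymond's lemma and representatives of BV functions -/

theorem exists_testFunction_integral_eq_one {a b : ℝ} (hab : a < b) :
    ∃ χ, IsTestFunction a b χ ∧ ∫ x, χ x = 1 := by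
  have hr : 0 < (b - a) / 4 := by linarith
  let B : ContDiffBump ((a + b) / 2) := ⟨(b - a) / 8, (b - a) / 4, by linarith, by linarith⟩
  refine ⟨B.normed volume, ⟨B.contDiff_normed, B.hasCompactSupport_normed, ?_⟩, B.integral_normed⟩
  rw [B.tsupport_normed_eq]
  intro x hx
  rw [Metric.mem_closedBall, Real.dist_eq, abs_le] at hx
  have : B.rOut = (b - a) / 4 := rfl
  rw [this] at hx
  constructor <;> linarith [hx.1, hx.2]

/-- A test function with integral zero is the derivative of a test function. -/
theorem IsTestFunction.exists_primitive {a b : ℝ} {g : ℝ → ℝ} (hg : IsTestFunction a b g)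
    (h0 : ∫ x, g x = 0) : ∃ η, IsTestFunction a b η ∧ deriv η = g := by
  rcases (tsupport g).eq_empty_or_nonempty with hK | hK
  · have : g = 0 := by rwa [tsupport_eq_empty_iff] at hK
    refine ⟨0, ⟨contDiff_const, HasCompactSupport.zero, by simp [tsupport]⟩, ?_⟩
    rw [this]; exact deriv_const' 0
  obtain ⟨c, hc, hc'⟩ := hg.hasCompactSupport.exists_isLeast hK
  obtain ⟨d, hd, hd'⟩ := hg.hasCompactSupport.exists_isGreatest hK
  have hca := hg.tsupport_subset hc
  have hdb := hg.tsupport_subset hd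
  have hsupp : ∀ x, x ∉ Icc c d → g x = 0 := fun x hx =>
    image_eq_zero_of_notMem_tsupport fun h => hx ⟨hc' h, hd' h⟩
  have hcont := hg.contDiff.continuous
  let η : ℝ → ℝ := fun x => ∫ t in a..x, g t
  have hd1 : ∀ x, HasDerivAt η (g x) x := fun x =>
    intervalIntegral.integral_hasDerivAt_right (hcont.intervalIntegrable _ _)
      (hcont.stronglyMeasurableAtFilter _ _) hcont.continuousAt
  have hder : deriv η = g := funext fun x => (hd1 x).deriv
  have hsub : tsupport η ⊆ Icc c d := by
    refine closure_minimal (fun x hx => ?_) isClosed_Icc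
    by_contra hcon
    refine hx ?_
    rcases lt_or_ge x c with hxc | hxc
    -- To the left of the support nothing has been integrated yet; to its right the whole integral
    -- has, and it is zero.
    · refine (intervalIntegral.integral_congr (g := fun _ => 0) fun t ht => hsupp t fun h => ?_).trans
        (by simp)
      have := ht.2.trans_lt (max_lt hca.1 hxc)
      exact absurd h.1 (not_le.2 this)
    · have hxd : d < x := by
        by_contra h; exact hcon ⟨hxc, not_lt.1 h⟩
      show ∫ t in a..x, g t = 0
      rw [intervalIntegral.integral_eq_integral_of_support_subset, h0]
      intro t ht
      by_contra h
      refine ht (hsupp t fun h' => h ⟨hca.1.trans_le h'.1, h'.2.trans hxd.le⟩)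
  refine ⟨η, ⟨?_, HasCompactSupport.of_support_subset_isCompact isCompact_Icc
    (subset_closure.trans hsub), fun x hx => ?_⟩, hder⟩
  · rw [contDiff_infty_iff_deriv, hder]
    exact ⟨fun x => (hd1 x).differentiableAt, hg.contDiff⟩
  · exact ⟨hca.1.trans_le (hsub hx).1, (hsub hx).2.trans_lt hdb.2⟩

/-- The lemma of du Bois-Reymond. -/
theorem ae_eq_const_of_integral_mul_deriv_eq_zero {a b : ℝ} (hab : a < b) {w : ℝ → ℝ}
    (hw : IntegrableOn w (Ioo a b))
    (h : ∀ η, IsTestFunction a b η → ∫ x in Ioo a b, w x * deriv η x = 0) :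
    ∃ K : ℝ, ∀ᵐ x ∂(volume.restrict (Ioo a b)), w x = K := by
  obtain ⟨χ, hχ, hχ1⟩ := exists_testFunction_integral_eq_one hab
  have hmul : ∀ g, IsTestFunction a b g → IntegrableOn (fun x => w x * g x) (Ioo a b) := by
    intro g hg
    obtain ⟨C, hC⟩ := hg.bounded
    exact hw.mul_bdd hg.contDiff.continuous.aestronglyMeasurable (ae_of_all _ hC)
  have hgi : ∀ g, IsTestFunction a b g → Integrable g := fun g hg =>
    hg.contDiff.continuous.integrable_of_hasCompactSupport hg.hasCompactSupport
  -- If w is constant, its value is its average against χ.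
  set K := ∫ x in Ioo a b, w x * χ x
  refine ⟨K, ?_⟩
  have hloc : LocallyIntegrableOn (fun x => w x - K) (Ioo a b) :=
    (hw.sub (integrableOn_const (by simp))).locallyIntegrableOn
  have := isOpen_Ioo.ae_eq_zero_of_integral_contDiff_smul_eq_zero (μ := volume) hloc ?_
  · rw [ae_restrict_iff' measurableSet_Ioo]
    filter_upwards [this] with x hx hxI
    linarith [hx hxI]
  intro g hg1 hg2 hg3
  have hg : IsTestFunction a b g := ⟨hg1, hg2, hg3⟩
  set J := ∫ x, g x
  -- Removing the multiple of χ with the same integral leaves mean zero, hence the derivative of a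
  -- test function.
  have hg0 : IsTestFunction a b (fun x => g x - J * χ x) := by
    have hs : tsupport (fun x => g x - J * χ x) ⊆ tsupport g ∪ tsupport χ := by
      refine closure_minimal (fun x hx => ?_) ((isClosed_tsupport _).union (isClosed_tsupport _))
      by_contra hcon
      rw [mem_union, not_or] at hcon
      refine hx ?_
      simp [image_eq_zero_of_notMem_tsupport hcon.1, image_eq_zero_of_notMem_tsupport hcon.2]
    exact ⟨hg.contDiff.sub (contDiff_const.mul hχ.contDiff),
      HasCompactSupport.of_support_subset_isCompact
        (hg.hasCompactSupport.isCompact.union hχ.hasCompactSupport.isCompact)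
        (subset_closure.trans hs), hs.trans (union_subset hg.tsupport_subset hχ.tsupport_subset)⟩
  obtain ⟨η, hη, hη'⟩ := hg0.exists_primitive (by
    rw [integral_sub (hgi g hg) ((hgi χ hχ).const_mul J), integral_const_mul, hχ1, mul_one, sub_self])
  have e := h η hη
  rw [hη'] at e
  have e2 : ∫ x in Ioo a b, w x * g x = J * K := by
    have : ∀ x, w x * (g x - J * χ x) = w x * g x - J * (w x * χ x) := fun x => by ring
    simp_rw [this] at e
    rw [integral_sub (hmul g hg) ((hmul χ hχ).const_mul J), integral_const_mul] at e
    linarith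
  have e3 : ∫ x in Ioo a b, g x = J :=
    setIntegral_eq_integral_of_forall_compl_eq_zero fun x hx => hg.eq_zero hx
  rw [← setIntegral_eq_integral_of_forall_compl_eq_zero (s := Ioo a b)
    fun x hx => by rw [hg.eq_zero hx, zero_smul]]
  have : ∀ x, g x • (w x - K) = w x * g x - K * g x := fun x => by rw [smul_eq_mul]; ring
  simp_rw [this]
  rw [integral_sub (hmul g hg) ((hgi g hg).integrableOn.const_mul K), integral_const_mul, e2, e3]
  ring

/-- The distribution function of μ also has derivative μ, so its difference from u has zero weak
derivative. -/
theorem HasBVDeriv.ae_eq_const_add {a b : ℝ} (hab : a < b) {u : ℝ → ℝ} {μ : SignedMeasure ℝ}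
    (hu : HasBVDeriv a b u μ) :
    ∃ K : ℝ, ∀ᵐ x ∂(volume.restrict (Ioo a b)), u x = K + μ (Iic x) := by
  have hp : StronglyMeasurable (polarDensity μ) :=
    (SignedMeasure.measurable_rnDeriv _ _).stronglyMeasurable
  have h1 := hasBVDeriv_cumulative hu.carried hp (integrable_polarDensity μ)
  have h2 : (fun x => ∫ y in Iic x, polarDensity μ y ∂μ.totalVariation) = fun x => μ (Iic x) := by
    ext x
    conv_rhs => rw [← withDensityᵥ_polarDensity μ]
    rw [withDensityᵥ_apply (integrable_polarDensity μ) measurableSet_Iic]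
  rw [withDensityᵥ_polarDensity, h2] at h1
  obtain ⟨K, hK⟩ := ae_eq_const_of_integral_mul_deriv_eq_zero hab
    (hu.integrableOn.sub h1.integrableOn) (fun η hη => by
      obtain ⟨C, hC⟩ := hη.hasCompactSupport.deriv.exists_bound_of_continuous hη.continuous_deriv
      have hb : ∀ w, IntegrableOn w (Ioo a b) → IntegrableOn (fun x => w x * deriv η x) (Ioo a b) :=
        fun w hw => hw.mul_bdd hη.continuous_deriv.aestronglyMeasurable (ae_of_all _ hC)
      simp_rw [Pi.sub_apply, sub_mul]
      rw [integral_sub (hb _ hu.integrableOn) (hb _ h1.integrableOn), hu.integral_eq η hη,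
        h1.integral_eq η hη, sub_self])
  refine ⟨K, ?_⟩
  filter_upwards [hK] with x hx
  rw [← hx]; simp

/-- If the derivative of `u` has at most one singular point `c`, then `u` is a primitive plus
a jump at `c`. -/
theorem HasBVDeriv.ae_eq_primitive_add_jump {a b c κ : ℝ} (hab : a < b) {u : ℝ → ℝ}
    {μ : SignedMeasure ℝ} (hu : HasBVDeriv a b u μ)
    (hκ : singPart μ = κ • (Measure.dirac c).toSignedMeasure) :
    ∃ K : ℝ, ∀ᵐ x ∂(volume.restrict (Ioo a b)),
      u x = K + (∫ t in c..x, acDensity μ t) + (if c ≤ x then κ else 0) := by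
  obtain ⟨K, hK⟩ := hu.ae_eq_const_add hab
  have hA : Integrable (acDensity μ) := SignedMeasure.integrable_rnDeriv _ _
  have hdec : singPart μ + (volume : Measure ℝ).withDensityᵥ (acDensity μ) = μ :=
    SignedMeasure.singularPart_add_withDensity_rnDeriv_eq _ _
  -- Moves the base point of the primitive from -∞ to c.
  refine ⟨K + ∫ t in Iic c, acDensity μ t, ?_⟩
  filter_upwards [hK] with x hx
  have e : μ (Iic x) = (if c ≤ x then κ else 0) + ∫ t in Iic x, acDensity μ t := by
    conv_lhs => rw [← hdec]
    rw [_root_.add_apply, withDensityᵥ_apply hA measurableSet_Iic, hκ, _root_.smul_apply,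
      Measure.toSignedMeasure_apply_measurable measurableSet_Iic]
    by_cases h : c ≤ x <;> simp [h, measureReal_def, indicator]
  rw [hx, e, ← intervalIntegral.integral_Iic_sub_Iic hA.integrableOn hA.integrableOn]
  ring

/-- A flux which is less than one in modulus off `c` allows a singular part at `c` only. -/
theorem singPart_eq_smul_dirac {a b c : ℝ} {u Ψ : ℝ → ℝ} {μ : SignedMeasure ℝ}
    (hu : HasBVDeriv a b u μ) (hΨ : ∀ᵐ x ∂(singPart μ).totalVariation,
      polarDensity (singPart μ) x = Ψ x) (h1 : ∀ x ∈ Ioo a b, x ≠ c → |Ψ x| < 1) :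
    ∃ r : ℝ, 0 ≤ r ∧ (r = 0 ∨ |Ψ c| = 1) ∧
      singPart μ = (r * Ψ c) • (Measure.dirac c).toSignedMeasure := by
  set s := singPart μ
  set σ := s.totalVariation
  have hσI : ∀ᵐ x ∂σ, x ∈ Ioo a b := by
    rw [ae_iff]
    exact le_antisymm ((totalVariation_singPart_le μ _).trans_eq hu.carried) (zero_le)
  have hσ : ∀ᵐ x ∂σ, x = c := by
    filter_upwards [hσI, hΨ, abs_polarDensity s] with x hx h2 h3
    by_contra hne
    have := h1 x hx hne
    rw [← h2, h3] at this
    exact lt_irrefl _ this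
  have hσr : σ.restrict {c} = σ := Measure.restrict_eq_self_of_ae_mem hσ
  have hσd : σ = σ {c} • Measure.dirac c := by rw [← Measure.restrict_singleton, hσr]
  -- r is the mass of |Dˢu| at c; if it is positive, an a.e. statement for |Dˢu| holds at c itself.
  refine ⟨σ.real {c}, measureReal_nonneg, ?_, ?_⟩
  · by_cases h0 : σ {c} = 0
    · left; simp [measureReal_def, h0]
    · right
      have : ∀ᵐ x ∂σ, |Ψ x| = 1 := by
        filter_upwards [hΨ, abs_polarDensity s] with x h2 h3
        rw [← h2, h3]
      rw [hσd, Measure.ae_ennreal_smul_measure_iff h0, ae_dirac_eq] at this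
      exact this
  · have hi := integrable_polarDensity s
    ext t ht
    conv_lhs => rw [← withDensityᵥ_polarDensity s]
    rw [withDensityᵥ_apply hi ht, _root_.smul_apply,
      Measure.toSignedMeasure_apply_measurable ht]
    have : ∫ x in t, polarDensity s x ∂σ = ∫ x in t, Ψ c ∂σ := by
      refine integral_congr_ae (ae_restrict_of_ae ?_)
      filter_upwards [hΨ, hσ] with x h2 h3
      rw [h2, h3]
    rw [this, setIntegral_const]
    have : σ.real t = σ.real {c} * (Measure.dirac c).real t := by
      conv_lhs => rw [hσd]
      simp [measureReal_def]
    rw [this]; simp only [smul_eq_mul]; ring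

/-! ### Absolute continuity and weak derivatives -/

theorem absolutelyContinuous_comp_of_lipschitzOnWith {T w : ℝ → ℝ} {K : NNReal} {s : Set ℝ} {c d : ℝ}
    (hT : LipschitzOnWith K T s) (hw : AbsolutelyContinuousOnInterval w c d)
    (hs : MapsTo w (uIcc c d) s) : AbsolutelyContinuousOnInterval (T ∘ w) c d := by
  rw [absolutelyContinuousOnInterval_iff] at hw ⊢
  intro ε hε
  -- K + 1 rather than K, because the Lipschitz constant may be zero.
  obtain ⟨δ, hδ, H⟩ := hw (ε / (K + 1)) (by positivity)
  refine ⟨δ, hδ, fun E hE hE' => ?_⟩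
  have h1 := H E hE hE'
  calc _ ≤ ∑ i ∈ Finset.range E.1, K * dist (w (E.2 i).1) (w (E.2 i).2) := by
        refine Finset.sum_le_sum fun i hi => ?_
        have := hE.1 i hi
        exact hT.dist_le_mul _ (hs this.1) _ (hs this.2)
    _ = K * ∑ i ∈ Finset.range E.1, dist (w (E.2 i).1) (w (E.2 i).2) := by rw [Finset.mul_sum]
    _ ≤ K * (ε / (K + 1)) := by gcongr
    _ < ε := by
        rw [mul_div_assoc', div_lt_iff₀ (by positivity)]
        nlinarith

/-- Integration by parts for absolutely continuous functions; test functions vanish at c and d. Only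
the open interval matters for v, so a jump of v at an endpoint is harmless. -/
theorem memW11_of_absolutelyContinuous {c d : ℝ} (hcd : c ≤ d) {v w : ℝ → ℝ}
    (hw : AbsolutelyContinuousOnInterval w c d) (hv : EqOn v w (Ioo c d)) :
    IntegrableOn v (Ioo c d) ∧ IntegrableOn (deriv w) (Ioo c d) ∧ HasWeakDeriv c d v (deriv w) := by
  have hc : ContinuousOn w (Icc c d) := by simpa [uIcc_of_le hcd] using hw.continuousOn
  have hd : IntegrableOn (deriv w) (Ioo c d) :=
    ((intervalIntegrable_iff_integrableOn_Ioc_of_le hcd).1 hw.intervalIntegrable_deriv).mono_set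
      Ioo_subset_Ioc_self
  refine ⟨((hc.integrableOn_Icc).mono_set Ioo_subset_Icc_self).congr_fun hv.symm measurableSet_Ioo,
    hd, fun η hη => ?_⟩
  have hηac : AbsolutelyContinuousOnInterval η c d :=
    (hη.contDiff.of_le (by simp)).contDiffOn.absolutelyContinuousOnInterval
  have := hw.integral_mul_deriv_eq_deriv_mul hηac
  rw [hη.eq_zero (x := c) (by simp), hη.eq_zero (x := d) (by simp),
    intervalIntegral.integral_of_le hcd, intervalIntegral.integral_of_le hcd,
    integral_Ioc_eq_integral_Ioo, integral_Ioc_eq_integral_Ioo] at this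
  rw [setIntegral_congr_fun (g := fun x => w x * deriv η x) measurableSet_Ioo
    fun x hx => by simp only [hv hx], this]
  ring

theorem HasWeakDeriv.congr_ae {c d : ℝ} {v g g' : ℝ → ℝ} (h : HasWeakDeriv c d v g)
    (hg : ∀ᵐ x ∂(volume.restrict (Ioo c d)), g x = g' x) : HasWeakDeriv c d v g' := by
  intro η hη
  rw [h η hη]
  congr 1
  refine integral_congr_ae ?_
  filter_upwards [hg] with x hx
  rw [hx]

theorem absolutelyContinuous_primitive {G : ℝ → ℝ} (hG : Integrable G) (K x₀ c d : ℝ) :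
    AbsolutelyContinuousOnInterval (fun x => K + ∫ t in x₀..x, G t) c d := by
  have h1 : AbsolutelyContinuousOnInterval (fun x => ∫ t in c..x, G t) c d :=
    (hG.intervalIntegrable).absolutelyContinuousOnInterval_intervalIntegral (by simp)
  have h2 : AbsolutelyContinuousOnInterval (fun _ : ℝ => K + ∫ t in x₀..c, G t) c d :=
    contDiffOn_const.absolutelyContinuousOnInterval
  have := h2.fun_add h1
  have e : (fun x => K + ∫ t in x₀..x, G t)
      = fun x => (K + ∫ t in x₀..c, G t) + ∫ t in c..x, G t := by
    ext x
    rw [add_assoc, intervalIntegral.integral_add_adjacent_intervals hG.intervalIntegrable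
      hG.intervalIntegrable]
  rw [e]
  exact this

theorem ae_hasDerivAt_primitive {G : ℝ → ℝ} (hG : Integrable G) (K x₀ : ℝ) :
    ∀ᵐ x, HasDerivAt (fun x => K + ∫ t in x₀..x, G t) (G x) x := by
  filter_upwards [_root_.LocallyIntegrable.ae_hasDerivAt_integral hG.locallyIntegrable] with x hx
  exact (hx x₀).const_add K

/-- A primitive of an integrable function has it as weak derivative. -/
theorem memW11_primitive {G v : ℝ → ℝ} (hG : Integrable G) {K x₀ c d : ℝ} (hcd : c ≤ d)
    (hv : EqOn v (fun x => K + ∫ t in x₀..x, G t) (Ioo c d)) :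
    IntegrableOn v (Ioo c d) ∧ HasWeakDeriv c d v G := by
  obtain ⟨h1, h2, h3⟩ := memW11_of_absolutelyContinuous hcd
    (absolutelyContinuous_primitive hG K x₀ c d) hv
  refine ⟨h1, h3.congr_ae (ae_restrict_of_ae ?_)⟩
  filter_upwards [ae_hasDerivAt_primitive hG K x₀] with x hx
  exact hx.deriv

/-! ### The inverse of the flux function -/

/-- The inverse of `t ↦ t / √(1 + t²)`. -/
def invFlux (s : ℝ) : ℝ := s / √(1 - s ^ 2)

theorem one_sub_sq_pos {s : ℝ} (hs : |s| < 1) : 0 < 1 - s ^ 2 := by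
  have := (sq_lt_one_iff_abs_lt_one s).2 hs
  linarith

theorem one_add_invFlux_sq {s : ℝ} (hs : |s| < 1) : 1 + invFlux s ^ 2 = 1 / (1 - s ^ 2) := by
  have h := one_sub_sq_pos hs
  rw [invFlux, div_pow, Real.sq_sqrt h.le]
  field_simp
  ring

theorem flux_invFlux {s : ℝ} (hs : |s| < 1) : invFlux s / √(1 + invFlux s ^ 2) = s := by
  have h := one_sub_sq_pos hs
  have h' : √(1 - s ^ 2) ≠ 0 := (Real.sqrt_pos.2 h).ne'
  rw [one_add_invFlux_sq hs, Real.sqrt_div zero_le_one, Real.sqrt_one, invFlux]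
  field_simp

theorem invFlux_flux (t : ℝ) : invFlux (t / √(1 + t ^ 2)) = t := by
  have h : 0 < 1 + t ^ 2 := by positivity
  have h' : √(1 + t ^ 2) ≠ 0 := (Real.sqrt_pos.2 h).ne'
  have : 1 - (t / √(1 + t ^ 2)) ^ 2 = 1 / (1 + t ^ 2) := by
    rw [div_pow, Real.sq_sqrt h.le]; field_simp; ring
  rw [invFlux, this, Real.sqrt_div zero_le_one, Real.sqrt_one]
  field_simp

/-- The derivative is (1 + t²)^(-3/2) > 0. -/
theorem strictMono_flux : StrictMono fun t : ℝ => t / √(1 + t ^ 2) := by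
  have hpos : ∀ x : ℝ, 0 < 1 + x ^ 2 := fun x => by positivity
  have hder : ∀ x : ℝ, HasDerivAt (fun t : ℝ => t / √(1 + t ^ 2))
      (1 / ((1 + x ^ 2) * √(1 + x ^ 2))) x := by
    intro x
    have h1 : HasDerivAt (fun t : ℝ => 1 + t ^ 2) (2 * x) x := by
      simpa using ((hasDerivAt_id x).pow 2).const_add 1
    have h2 := (hasDerivAt_id x).div (h1.sqrt (hpos x).ne') (Real.sqrt_pos.2 (hpos x)).ne'
    refine h2.congr_deriv ?_
    have h3 := Real.sq_sqrt (hpos x).le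
    have h4 : √(1 + x ^ 2) ≠ 0 := (Real.sqrt_pos.2 (hpos x)).ne'
    have h5 := (hpos x).ne'
    simp only [id]
    field_simp
    rw [h3]; ring
  refine strictMono_of_deriv_pos fun x => ?_
  rw [(hder x).deriv]
  have := Real.sqrt_pos.2 (hpos x)
  have := hpos x
  positivity

theorem invFlux_le_invFlux {s t : ℝ} (hs : |s| < 1) (ht : |t| < 1) (h : s ≤ t) :
    invFlux s ≤ invFlux t := by
  rw [← strictMono_flux.le_iff_le]
  simpa only [flux_invFlux hs, flux_invFlux ht] using h

theorem contDiffOn_invFlux : ContDiffOn ℝ 1 invFlux (Ioo (-1) 1) := by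
  unfold invFlux
  refine contDiffOn_id.div (ContDiffOn.sqrt (by fun_prop) fun x hx => ?_) fun x hx => ?_
  · exact (one_sub_sq_pos (abs_lt.2 hx)).ne'
  · exact (Real.sqrt_pos.2 (one_sub_sq_pos (abs_lt.2 hx))).ne'

theorem continuousAt_invFlux {s : ℝ} (hs : |s| < 1) : ContinuousAt invFlux s :=
  contDiffOn_invFlux.continuousOn.continuousAt (Ioo_mem_nhds (abs_lt.1 hs).1 (abs_lt.1 hs).2)

theorem tendsto_invFlux_atTop : Tendsto invFlux (𝓝[<] 1) atTop := by
  have h1 : Tendsto (fun s : ℝ => √(1 - s ^ 2)) (𝓝[<] 1) (𝓝[>] 0) := by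
    refine tendsto_nhdsWithin_iff.2 ⟨?_, ?_⟩
    · have : Continuous fun s : ℝ => √(1 - s ^ 2) := by fun_prop
      simpa using (this.tendsto 1).mono_left nhdsWithin_le_nhds
    · filter_upwards [Ioo_mem_nhdsLT (show (-1 : ℝ) < 1 by norm_num)] with s hs
      exact Real.sqrt_pos.2 (one_sub_sq_pos (abs_lt.2 hs))
  have h2 : Tendsto (fun s : ℝ => s) (𝓝[<] 1) (𝓝 1) := nhdsWithin_le_nhds
  exact h2.pos_mul_atTop one_pos (tendsto_inv_nhdsGT_zero.comp h1)

theorem invFlux_neg (s : ℝ) : invFlux (-s) = - invFlux s := by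
  simp [invFlux, neg_div]

theorem tendsto_invFlux_atBot : Tendsto invFlux (𝓝[>] (-1)) atBot := by
  have h1 : Tendsto (fun s : ℝ => -s) (𝓝[>] (-1)) (𝓝[<] 1) := by
    have := tendsto_neg_nhdsGT (a := (-1 : ℝ))
    simpa using this
  have := tendsto_neg_atTop_atBot.comp (tendsto_invFlux_atTop.comp h1)
  refine this.congr fun s => ?_
  simp [invFlux_neg]

/-! ### Monotone fluxes and where they can reach ±1 -/

theorem exists_mem_Ioo_of_ae {a b s t : ℝ} {P : ℝ → Prop} (hst : s < t) (has : a ≤ s) (htb : t ≤ b)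
    (h : ∀ᵐ x ∂(volume.restrict (Ioo a b)), P x) : ∃ x ∈ Ioo s t, P x := by
  have h' : ∀ᵐ x ∂(volume.restrict (Ioo s t)), P x ∧ x ∈ Ioo s t :=
    (ae_restrict_of_ae_restrict_of_subset (Ioo_subset_Ioo has htb) h).and
      (ae_restrict_mem measurableSet_Ioo)
  have : (ae (volume.restrict (Ioo s t))).NeBot := by
    rw [ae_neBot, Ne, Measure.restrict_eq_zero]
    simp [hst]
  obtain ⟨x, hx⟩ := h'.exists
  exact ⟨x, hx.2, hx.1⟩

/-- A primitive of `-h`. -/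
def IsFluxOf (h Ψ : ℝ → ℝ) : Prop := Integrable h ∧ ∀ x y, Ψ y = Ψ x - ∫ t in x..y, h t

section IsFluxOf

variable {h Ψ : ℝ → ℝ} {a b s t x : ℝ}

theorem IsFluxOf.eq_primitive (H : IsFluxOf h Ψ) :
    Ψ = fun x => Ψ 0 + ∫ t in (0)..x, (-h) t := by
  ext x
  rw [H.2 0 x]
  simp [intervalIntegral.integral_neg, sub_eq_add_neg]

theorem IsFluxOf.absolutelyContinuous (H : IsFluxOf h Ψ) (s t : ℝ) :
    AbsolutelyContinuousOnInterval Ψ s t := by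
  rw [H.eq_primitive]
  exact absolutelyContinuous_primitive H.1.neg _ _ _ _

theorem IsFluxOf.continuous (H : IsFluxOf h Ψ) : Continuous Ψ := by
  rw [H.eq_primitive]
  exact (intervalIntegral.continuous_primitive (fun _ _ => H.1.neg.intervalIntegrable) 0).const_add _

theorem IsFluxOf.ae_hasDerivAt (H : IsFluxOf h Ψ) : ∀ᵐ x, HasDerivAt Ψ (-h x) x := by
  rw [H.eq_primitive]
  exact ae_hasDerivAt_primitive H.1.neg _ _

theorem IsFluxOf.antitoneOn (H : IsFluxOf h Ψ)
    (hh : ∀ᵐ x ∂(volume.restrict (Ioo s t)), 0 ≤ h x) : AntitoneOn Ψ (Icc s t) := by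
  intro x hx y hy hxy
  rw [H.2 x y, intervalIntegral.integral_of_le hxy, integral_Ioc_eq_integral_Ioo]
  have := integral_nonneg_of_ae
    (ae_restrict_of_ae_restrict_of_subset (Ioo_subset_Ioo hx.1 hy.2) hh)
  linarith

theorem IsFluxOf.monotoneOn (H : IsFluxOf h Ψ)
    (hh : ∀ᵐ x ∂(volume.restrict (Ioo s t)), h x ≤ 0) : MonotoneOn Ψ (Icc s t) := by
  intro x hx y hy hxy
  rw [H.2 x y, intervalIntegral.integral_of_le hxy, integral_Ioc_eq_integral_Ioo]
  have := integral_nonpos_of_ae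
    (ae_restrict_of_ae_restrict_of_subset (Ioo_subset_Ioo hx.1 hy.2) hh)
  linarith

/-- Some y in (s, x) has Ψ y < 1, and Ψ x ≤ Ψ y. So 1 can only be attained at the left end s, while
x = t is allowed. The next three lemmas are the mirror images. -/
theorem lt_one_of_antitoneOn (hm : AntitoneOn Ψ (Icc s t)) (has : a ≤ s) (htb : t ≤ b)
    (h1 : ∀ᵐ x ∂(volume.restrict (Ioo a b)), |Ψ x| < 1) (hsx : s < x) (hxt : x ≤ t) :
    Ψ x < 1 := by
  obtain ⟨y, hy, hy1⟩ := exists_mem_Ioo_of_ae hsx has (hxt.trans htb) h1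
  exact (hm ⟨hy.1.le, hy.2.le.trans hxt⟩ ⟨hsx.le, hxt⟩ hy.2.le).trans_lt (abs_lt.1 hy1).2

theorem neg_one_lt_of_antitoneOn (hm : AntitoneOn Ψ (Icc s t)) (has : a ≤ s) (htb : t ≤ b)
    (h1 : ∀ᵐ x ∂(volume.restrict (Ioo a b)), |Ψ x| < 1) (hsx : s ≤ x) (hxt : x < t) :
    -1 < Ψ x := by
  obtain ⟨y, hy, hy1⟩ := exists_mem_Ioo_of_ae hxt (has.trans hsx) htb h1
  exact (abs_lt.1 hy1).1.trans_le (hm ⟨hsx, hxt.le⟩ ⟨hsx.trans hy.1.le, hy.2.le⟩ hy.1.le)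

theorem lt_one_of_monotoneOn (hm : MonotoneOn Ψ (Icc s t)) (has : a ≤ s) (htb : t ≤ b)
    (h1 : ∀ᵐ x ∂(volume.restrict (Ioo a b)), |Ψ x| < 1) (hsx : s ≤ x) (hxt : x < t) :
    Ψ x < 1 := by
  obtain ⟨y, hy, hy1⟩ := exists_mem_Ioo_of_ae hxt (has.trans hsx) htb h1
  exact (hm ⟨hsx, hxt.le⟩ ⟨hsx.trans hy.1.le, hy.2.le⟩ hy.1.le).trans_lt (abs_lt.1 hy1).2

theorem neg_one_lt_of_monotoneOn (hm : MonotoneOn Ψ (Icc s t)) (has : a ≤ s) (htb : t ≤ b)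
    (h1 : ∀ᵐ x ∂(volume.restrict (Ioo a b)), |Ψ x| < 1) (hsx : s < x) (hxt : x ≤ t) :
    -1 < Ψ x := by
  obtain ⟨y, hy, hy1⟩ := exists_mem_Ioo_of_ae hsx has (hxt.trans htb) h1
  exact (abs_lt.1 hy1).1.trans_le (hm ⟨hy.1.le, hy.2.le.trans hxt⟩ ⟨hsx.le, hxt⟩ hy.2.le)

theorem abs_le_one_of_ae (hab : a < b) (hΨ : Continuous Ψ)
    (h1 : ∀ᵐ x ∂(volume.restrict (Ioo a b)), |Ψ x| < 1) (hx : x ∈ Icc a b) : |Ψ x| ≤ 1 := by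
  have hcl : IsClosed {y | |Ψ y| ≤ 1} := isClosed_le hΨ.abs continuous_const
  have hsub : Ioo a b ⊆ {y | |Ψ y| ≤ 1} := by
    intro y hy
    -- Points with |Ψ| < 1 occur arbitrarily close to the left of y.
    refine hcl.closure_subset (Metric.mem_closure_iff.2 fun ε hε => ?_)
    obtain ⟨z, hz, hz1⟩ := exists_mem_Ioo_of_ae
      (s := max a (y - ε)) (t := y) (max_lt hy.1 (by linarith)) (le_max_left _ _) hy.2.le h1
    refine ⟨z, hz1.le, ?_⟩
    have := (le_max_right _ _).trans_lt hz.1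
    rw [Real.dist_eq, abs_lt]
    constructor <;> linarith [hz.2]
  have := hcl.closure_subset_iff.2 hsub
  rw [closure_Ioo hab.ne] at this
  exact this hx

end IsFluxOf

/-! ### The good representative and its regularity -/

/-- The function with derivative `G` off `c`, left limit `K` and a jump of height `κ` at `c`. -/
def primitiveWithJump (G : ℝ → ℝ) (c K κ : ℝ) (x : ℝ) : ℝ :=
  K + (∫ t in c..x, G t) + (if c ≤ x then κ else 0)

/-- The slope of a solution with flux `Ψ`. -/
def slope (a b : ℝ) (Ψ : ℝ → ℝ) : ℝ → ℝ := (Ioo a b).indicator (invFlux ∘ Ψ)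

theorem IsBVSolution.exists_isFluxOf {f : ℝ → ℝ → ℝ} {a b : ℝ} {u : ℝ → ℝ}
    (hu : IsBVSolution f a b u) :
    ∃ (μ : SignedMeasure ℝ) (Ψ : ℝ → ℝ), HasBVDeriv a b u μ ∧
      IsFluxOf ((Ioo a b).indicator fun t => f t (u t)) Ψ ∧
      (∀ᵐ x ∂(volume.restrict (Ioo a b)), acDensity μ x / √(1 + acDensity μ x ^ 2) = Ψ x) ∧
      (∀ᵐ x ∂(singPart μ).totalVariation, polarDensity (singPart μ) x = Ψ x) := by
  obtain ⟨μ, hμ, C, h1, h2⟩ := exists_flux hu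
  have hi : Integrable ((Ioo a b).indicator fun t => f t (u t)) :=
    (integrable_indicator_iff measurableSet_Ioo).2 hu.1
  refine ⟨μ, _, hμ, ⟨hi, fun x y => ?_⟩, h1, h2⟩
  have := intervalIntegral.integral_add_adjacent_intervals (hi.intervalIntegrable (a := x) (b := y))
    (hi.intervalIntegrable (b := b))
  linarith

/-- A solution whose flux `Ψ` is less than one in modulus off the point `c`, with left trace `K`
and jump `κ` at `c`. -/
structure IsFluxSolution (f : ℝ → ℝ → ℝ) (a b : ℝ) (u : ℝ → ℝ) (c : ℝ) (Ψ : ℝ → ℝ) (K κ : ℝ) :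
    Prop where
  mem : c ∈ Ioo a b
  isFluxOf : IsFluxOf ((Ioo a b).indicator fun t => f t (u t)) Ψ
  abs_lt : ∀ x ∈ Ioo a b, x ≠ c → |Ψ x| < 1
  abs_le : ∀ x ∈ Icc a b, |Ψ x| ≤ 1
  integrable : Integrable (slope a b Ψ)
  jump : ∃ r : ℝ, 0 ≤ r ∧ (r = 0 ∨ |Ψ c| = 1) ∧ κ = r * Ψ c
  ae_eq : primitiveWithJump (slope a b Ψ) c K κ =ᵐ[volume.restrict (Ioo a b)] u
  singPart : ∃ μ, HasBVDeriv a b u μ ∧ singPart μ = κ • (Measure.dirac c).toSignedMeasure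

/-- Inverting the flux identifies Dᵃu with the slope a.e., which also makes the slope integrable;
the bound off c confines Dˢu to a point mass at c. -/
theorem exists_isFluxSolution {f : ℝ → ℝ → ℝ} {a b c : ℝ} {u Ψ : ℝ → ℝ} {μ : SignedMeasure ℝ}
    (hc : c ∈ Ioo a b) (hμ : HasBVDeriv a b u μ)
    (hΨ : IsFluxOf ((Ioo a b).indicator fun t => f t (u t)) Ψ)
    (h1 : ∀ᵐ x ∂(volume.restrict (Ioo a b)), acDensity μ x / √(1 + acDensity μ x ^ 2) = Ψ x)
    (h2 : ∀ᵐ x ∂(singPart μ).totalVariation, polarDensity (singPart μ) x = Ψ x)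
    (h3 : ∀ x ∈ Ioo a b, x ≠ c → |Ψ x| < 1) :
    ∃ K κ, IsFluxSolution f a b u c Ψ K κ := by
  obtain ⟨r, hr, hr1, hs⟩ := singPart_eq_smul_dirac hμ h2 h3
  have hab : a < b := hc.1.trans hc.2
  obtain ⟨K, hK⟩ := hμ.ae_eq_primitive_add_jump hab hs
  have hA : Integrable (acDensity μ) := SignedMeasure.integrable_rnDeriv _ _
  have h1' : ∀ᵐ x, x ∈ Ioo a b → acDensity μ x = slope a b Ψ x := by
    rw [← ae_restrict_iff' measurableSet_Ioo]
    filter_upwards [h1, ae_restrict_mem measurableSet_Ioo] with x hx hxI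
    rw [slope, indicator_of_mem hxI, Function.comp, ← hx, invFlux_flux]
  have hG : Integrable (slope a b Ψ) := by
    refine (hA.indicator measurableSet_Ioo).congr (f := (Ioo a b).indicator (acDensity μ)) ?_
    filter_upwards [h1'] with x hx
    by_cases hxI : x ∈ Ioo a b
    · rw [indicator_of_mem hxI, hx hxI]
    · rw [indicator_of_notMem hxI, slope, indicator_of_notMem hxI]
  refine ⟨K, r * Ψ c, hc, hΨ, h3, fun x hx => abs_le_one_of_ae hab hΨ.continuous ?_ hx, hG,
    ⟨r, hr, hr1, rfl⟩, ?_, μ, hμ, hs⟩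
  · filter_upwards [h1] with x hx
    rw [← hx]; exact abs_div_sqrt_one_add_sq_lt _
  · filter_upwards [hK, ae_restrict_mem measurableSet_Ioo] with x hx hxI
    rw [hx, primitiveWithJump]
    congr 2
    refine intervalIntegral.integral_congr_ae ?_
    filter_upwards [h1'] with y hy hyI
    exact (hy (ordConnected_Ioo.uIcc_subset hc hxI (uIoc_subset_uIcc hyI))).symm

namespace IsFluxSolution

variable {f : ℝ → ℝ → ℝ} {a b c K κ s t x₀ : ℝ} {u Ψ : ℝ → ℝ}

theorem jump_eq_zero (S : IsFluxSolution f a b u c Ψ K κ) (h : |Ψ c| < 1) : κ = 0 := by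
  obtain ⟨r, _, hr, rfl⟩ := S.jump
  rcases hr with rfl | hr
  · simp
  · exact absurd hr h.ne

/-- On an interval without c inside, the jump term is constant and is absorbed by K'. -/
theorem eqOn_primitive (h : κ = 0 ∨ t ≤ c ∨ c ≤ s) (G : ℝ → ℝ) :
    ∃ K', EqOn (primitiveWithJump G c K κ) (fun x => K' + ∫ y in c..x, G y) (Ioo s t) := by
  rcases h with rfl | h | h
  · exact ⟨K, fun x _ => by simp [primitiveWithJump]⟩
  · exact ⟨K, fun x hx => by simp [primitiveWithJump, not_le.2 (hx.2.trans_le h)]⟩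
  · exact ⟨K + κ, fun x hx => by simp [primitiveWithJump, h.trans hx.1.le]; ring⟩

/-- The slope is continuous wherever |Ψ| < 1, so the fundamental theorem of calculus holds at that
very point, not just a.e. The point c is included, as there is then no jump. -/
theorem hasDerivAt (S : IsFluxSolution f a b u c Ψ K κ) {x : ℝ} (hx : x ∈ Ioo a b)
    (h : |Ψ x| < 1) : HasDerivAt (primitiveWithJump (slope a b Ψ) c K κ) (invFlux (Ψ x)) x := by
  have h' : ∃ s t, x ∈ Ioo s t ∧ (κ = 0 ∨ t ≤ c ∨ c ≤ s) := by
    rcases lt_trichotomy x c with hxc | rfl | hxc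
    · exact ⟨x - 1, c, ⟨by linarith, hxc⟩, Or.inr (Or.inl le_rfl)⟩
    · exact ⟨x - 1, x + 1, ⟨by linarith, by linarith⟩, Or.inl (S.jump_eq_zero h)⟩
    · exact ⟨c, x + 1, ⟨hxc, by linarith⟩, Or.inr (Or.inr le_rfl)⟩
  obtain ⟨s, t, hst, h'⟩ := h'
  obtain ⟨K', hK'⟩ := eqOn_primitive (K := K) h' (slope a b Ψ)
  have hev : slope a b Ψ =ᶠ[𝓝 x] invFlux ∘ Ψ := by
    filter_upwards [Ioo_mem_nhds hx.1 hx.2] with y hy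
    rw [slope, indicator_of_mem hy]
  have hcont : ContinuousAt (slope a b Ψ) x :=
    ((continuousAt_invFlux h).comp S.isFluxOf.continuous.continuousAt).congr hev.symm
  have hd : HasDerivAt (fun x => K' + ∫ y in c..x, slope a b Ψ y) (invFlux (Ψ x)) x := by
    have := (intervalIntegral.integral_hasDerivAt_right
      (S.integrable.intervalIntegrable (a := c) (b := x))
      (S.integrable.1.stronglyMeasurableAtFilter) hcont).const_add K'
    rwa [hev.eq_of_nhds] at this
  exact hd.congr_of_eventuallyEq (by
    filter_upwards [Ioo_mem_nhds hst.1 hst.2] with y hy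
    exact hK' hy)

theorem deriv_eq (S : IsFluxSolution f a b u c Ψ K κ) {x : ℝ} (hx : x ∈ Ioo a b)
    (h : |Ψ x| < 1) : deriv (primitiveWithJump (slope a b Ψ) c K κ) x = invFlux (Ψ x) :=
  (S.hasDerivAt hx h).deriv

theorem satisfiesEqAE (S : IsFluxSolution f a b u c Ψ K κ) :
    SatisfiesEqAE f a b (primitiveWithJump (slope a b Ψ) c K κ) := by
  have hne : ∀ᵐ x : ℝ, x ≠ c := by simp [ae_iff]
  filter_upwards [ae_restrict_mem measurableSet_Ioo, ae_restrict_of_ae hne,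
    ae_restrict_of_ae S.isFluxOf.ae_hasDerivAt, S.ae_eq] with x hx hxc hd hu
  have hev : ∀ᶠ y in 𝓝 x, y ∈ Ioo a b ∧ |Ψ y| < 1 := by
    filter_upwards [Ioo_mem_nhds hx.1 hx.2, isOpen_ne.mem_nhds hxc] with y hy hyc
    exact ⟨hy, S.abs_lt y hy hyc⟩
  refine ⟨hev.mono fun y hy => (S.hasDerivAt hy.1 hy.2).differentiableAt, ?_⟩
  rw [indicator_of_mem hx, ← hu] at hd
  refine hd.congr_of_eventuallyEq ?_
  filter_upwards [hev] with y hy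
  rw [S.deriv_eq hy.1 hy.2, flux_invFlux hy.2]

theorem memW11 (S : IsFluxSolution f a b u c Ψ K κ) (hst : s ≤ t) (h : κ = 0 ∨ t ≤ c ∨ c ≤ s) :
    MemW11 s t (primitiveWithJump (slope a b Ψ) c K κ) := by
  obtain ⟨K', hK'⟩ := eqOn_primitive (K := K) h (slope a b Ψ)
  obtain ⟨h1, h2⟩ := memW11_primitive S.integrable hst hK'
  exact ⟨h1, _, S.integrable.integrableOn, h2⟩

/-- By compactness Ψ maps [s, t] into a compact subinterval of (-1, 1), on which `invFlux` is
Lipschitz. Hence the slope inherits absolute continuity from Ψ. -/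
theorem memW21 (S : IsFluxSolution f a b u c Ψ K κ) (hst : s ≤ t) (has : a ≤ s) (htb : t ≤ b)
    (h : κ = 0 ∨ t ≤ c ∨ c ≤ s) (hΨ : ∀ x ∈ Icc s t, |Ψ x| < 1) :
    MemW21 s t (primitiveWithJump (slope a b Ψ) c K κ) := by
  obtain ⟨K', hK'⟩ := eqOn_primitive (K := K) h (slope a b Ψ)
  obtain ⟨h1, h2⟩ := memW11_primitive S.integrable hst hK'
  have hne : (Icc s t).Nonempty := nonempty_Icc.2 hst
  have hc := S.isFluxOf.continuous.continuousOn (s := Icc s t)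
  obtain ⟨p, hp, hpm⟩ := isCompact_Icc.exists_isMinOn hne hc
  obtain ⟨q, hq, hqm⟩ := isCompact_Icc.exists_isMaxOn hne hc
  have hsub : Icc (Ψ p) (Ψ q) ⊆ Ioo (-1) 1 := fun y hy =>
    ⟨(_root_.abs_lt.1 (hΨ p hp)).1.trans_le hy.1, hy.2.trans_lt (_root_.abs_lt.1 (hΨ q hq)).2⟩
  obtain ⟨L, hL⟩ := (contDiffOn_invFlux.mono hsub).exists_lipschitzOnWith (by decide)
    (convex_Icc _ _) isCompact_Icc
  have hac := absolutelyContinuous_comp_of_lipschitzOnWith hL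
    (S.isFluxOf.absolutelyContinuous s t) (fun x hx => by
      rw [uIcc_of_le hst] at hx
      exact ⟨hpm hx, hqm hx⟩)
  obtain ⟨h3, h4, h5⟩ := memW11_of_absolutelyContinuous hst hac (v := slope a b Ψ) (fun x hx => by
    rw [slope, indicator_of_mem (Ioo_subset_Ioo has htb hx)])
  exact ⟨h1, _, ⟨h3, _, h4, h5⟩, h2⟩

theorem concaveOn (S : IsFluxSolution f a b u c Ψ K κ) (hst : Ioo s t ⊆ Ioo a b)
    (hΨ : ∀ x ∈ Ioo s t, |Ψ x| < 1) (hm : AntitoneOn Ψ (Icc s t)) :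
    ConcaveOn ℝ (Ioo s t) (primitiveWithJump (slope a b Ψ) c K κ) := by
  refine AntitoneOn.concaveOn_of_deriv (convex_Ioo _ _)
    (fun x hx => (S.hasDerivAt (hst hx) (hΨ x hx)).continuousAt.continuousWithinAt) ?_ ?_ <;>
  rw [interior_Ioo]
  · exact fun x hx => (S.hasDerivAt (hst hx) (hΨ x hx)).differentiableAt.differentiableWithinAt
  · intro x hx y hy hxy
    rw [S.deriv_eq (hst hx) (hΨ x hx), S.deriv_eq (hst hy) (hΨ y hy)]
    exact invFlux_le_invFlux (hΨ y hy) (hΨ x hx)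
      (hm (Ioo_subset_Icc_self hx) (Ioo_subset_Icc_self hy) hxy)

theorem convexOn (S : IsFluxSolution f a b u c Ψ K κ) (hst : Ioo s t ⊆ Ioo a b)
    (hΨ : ∀ x ∈ Ioo s t, |Ψ x| < 1) (hm : MonotoneOn Ψ (Icc s t)) :
    ConvexOn ℝ (Ioo s t) (primitiveWithJump (slope a b Ψ) c K κ) := by
  refine MonotoneOn.convexOn_of_deriv (convex_Ioo _ _)
    (fun x hx => (S.hasDerivAt (hst hx) (hΨ x hx)).continuousAt.continuousWithinAt) ?_ ?_ <;>
  rw [interior_Ioo]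
  · exact fun x hx => (S.hasDerivAt (hst hx) (hΨ x hx)).differentiableAt.differentiableWithinAt
  · intro x hx y hy hxy
    rw [S.deriv_eq (hst hx) (hΨ x hx), S.deriv_eq (hst hy) (hΨ y hy)]
    exact invFlux_le_invFlux (hΨ x hx) (hΨ y hy)
      (hm (Ioo_subset_Icc_self hx) (Ioo_subset_Icc_self hy) hxy)

/-- Along l the flux tends to 1 from strictly below, where `invFlux` blows up. A general filter
serves one-sided limits at a, b and c alike. -/
theorem tendsto_deriv_atTop (S : IsFluxSolution f a b u c Ψ K κ) {l : Filter ℝ} (hl : l ≤ 𝓝 x₀)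
    (hev : ∀ᶠ x in l, x ∈ Ioo a b ∧ x ≠ c) (h : Ψ x₀ = 1) :
    Tendsto (deriv (primitiveWithJump (slope a b Ψ) c K κ)) l atTop := by
  have hev' : ∀ᶠ x in l, x ∈ Ioo a b ∧ |Ψ x| < 1 :=
    hev.mono fun x hx => ⟨hx.1, S.abs_lt x hx.1 hx.2⟩
  have h1 : Tendsto Ψ l (𝓝[<] 1) :=
    tendsto_nhdsWithin_iff.2 ⟨h ▸ (S.isFluxOf.continuous.tendsto x₀).mono_left hl,
      hev'.mono fun x hx => (_root_.abs_lt.1 hx.2).2⟩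
  exact (tendsto_invFlux_atTop.comp h1).congr' (hev'.mono fun x hx => (S.deriv_eq hx.1 hx.2).symm)

theorem tendsto_deriv_atBot (S : IsFluxSolution f a b u c Ψ K κ) {l : Filter ℝ} (hl : l ≤ 𝓝 x₀)
    (hev : ∀ᶠ x in l, x ∈ Ioo a b ∧ x ≠ c) (h : Ψ x₀ = -1) :
    Tendsto (deriv (primitiveWithJump (slope a b Ψ) c K κ)) l atBot := by
  have hev' : ∀ᶠ x in l, x ∈ Ioo a b ∧ |Ψ x| < 1 :=
    hev.mono fun x hx => ⟨hx.1, S.abs_lt x hx.1 hx.2⟩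
  have h1 : Tendsto Ψ l (𝓝[>] (-1)) :=
    tendsto_nhdsWithin_iff.2 ⟨h ▸ (S.isFluxOf.continuous.tendsto x₀).mono_left hl,
      hev'.mono fun x hx => (_root_.abs_lt.1 hx.2).1⟩
  exact (tendsto_invFlux_atBot.comp h1).congr' (hev'.mono fun x hx => (S.deriv_eq hx.1 hx.2).symm)

theorem hasLeftTrace (S : IsFluxSolution f a b u c Ψ K κ) :
    HasLeftTrace (primitiveWithJump (slope a b Ψ) c K κ) c K := by
  have h1 : Tendsto (fun x => K + ∫ y in c..x, slope a b Ψ y) (𝓝[<] c) (𝓝 K) := by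
    have := ((intervalIntegral.continuous_primitive
      (fun _ _ => S.integrable.intervalIntegrable) c).const_add K).tendsto c
    simp only [intervalIntegral.integral_same, add_zero] at this
    exact this.mono_left nhdsWithin_le_nhds
  refine (h1.congr' ?_).mono_left inf_le_left
  filter_upwards [self_mem_nhdsWithin] with x hx
  simp [primitiveWithJump, not_le.2 (show x < c from hx)]

theorem hasRightTrace (S : IsFluxSolution f a b u c Ψ K κ) :
    HasRightTrace (primitiveWithJump (slope a b Ψ) c K κ) c (K + κ) := by
  have h1 : Tendsto (fun x => K + κ + ∫ y in c..x, slope a b Ψ y) (𝓝[>] c) (𝓝 (K + κ)) := by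
    have := ((intervalIntegral.continuous_primitive
      (fun _ _ => S.integrable.intervalIntegrable) c).const_add (K + κ)).tendsto c
    simp only [intervalIntegral.integral_same, add_zero] at this
    exact this.mono_left nhdsWithin_le_nhds
  refine (h1.congr' ?_).mono_left inf_le_left
  filter_upwards [self_mem_nhdsWithin] with x hx
  simp [primitiveWithJump, (show c < x from hx).le]
  ring

theorem singPartIsJump (S : IsFluxSolution f a b u c Ψ K κ) :
    SingPartIsJump a b (primitiveWithJump (slope a b Ψ) c K κ) c K (K + κ) := by
  obtain ⟨μ, hμ, hs⟩ := S.singPart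
  refine ⟨μ, ⟨hμ.integrableOn.congr S.ae_eq.symm, hμ.carried, fun η hη => ?_⟩, ?_⟩
  · rw [← hμ.integral_eq η hη]
    refine integral_congr_ae ?_
    filter_upwards [S.ae_eq] with x hx
    rw [hx]
  · rw [hs, add_sub_cancel_left]

end IsFluxSolution

/-! ### The four cases of the theorem -/

theorem IsBVSolution.exists_concave {f : ℝ → ℝ → ℝ} {a b : ℝ} {u : ℝ → ℝ} (hab : a < b)
    (hu : IsBVSolution f a b u) (hf : ∀ᵐ x ∂(volume.restrict (Ioo a b)), 0 ≤ f x (u x)) :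
    ∃ v : ℝ → ℝ, v =ᵐ[volume.restrict (Ioo a b)] u ∧
      ConcaveOn ℝ (Ioo a b) v ∧
      (MemW21 a b v ∨
        (MemW21locCO a b v ∧ MemW11 a b v ∧ Tendsto (deriv v) (𝓝[<] b) atBot) ∨
        (MemW21locOC a b v ∧ MemW11 a b v ∧ Tendsto (deriv v) (𝓝[>] a) atTop) ∨
        (MemW21locOO a b v ∧ MemW11 a b v ∧
          Tendsto (deriv v) (𝓝[>] a) atTop ∧ Tendsto (deriv v) (𝓝[<] b) atBot)) ∧
      SatisfiesEqAE f a b v := by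
  obtain ⟨μ, Ψ, hμ, hΨ, h1, h2⟩ := hu.exists_isFluxOf
  have hlt : ∀ᵐ x ∂(volume.restrict (Ioo a b)), |Ψ x| < 1 := by
    filter_upwards [h1] with x hx
    rw [← hx]; exact abs_div_sqrt_one_add_sq_lt _
  have hm : AntitoneOn Ψ (Icc a b) := hΨ.antitoneOn (by
    filter_upwards [hf, ae_restrict_mem measurableSet_Ioo] with x hx hxI
    rwa [indicator_of_mem hxI])
  have upper : ∀ x, a ≤ x → x ≤ b → (x ≠ a ∨ Ψ a < 1) → Ψ x < 1 := fun x hax hxb h => by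
    rcases hax.eq_or_lt with rfl | hax
    · simpa using h
    · exact lt_one_of_antitoneOn hm le_rfl le_rfl hlt hax hxb
  have lower : ∀ x, a ≤ x → x ≤ b → (x ≠ b ∨ -1 < Ψ b) → -1 < Ψ x := fun x hax hxb h => by
    rcases hxb.eq_or_lt with rfl | hxb
    · simpa using h
    · exact neg_one_lt_of_antitoneOn hm le_rfl le_rfl hlt hax hxb
  have hin : ∀ x ∈ Ioo a b, |Ψ x| < 1 := fun x hx =>
    abs_lt.2 ⟨lower x hx.1.le hx.2.le (Or.inl hx.2.ne),
      upper x hx.1.le hx.2.le (Or.inl hx.1.ne')⟩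
  -- Any interior point would do as base point: |Ψ| < 1 there, so the jump is zero.
  have hc : (a + b) / 2 ∈ Ioo a b := ⟨by linarith, by linarith⟩
  obtain ⟨K, κ, S⟩ := exists_isFluxSolution hc hμ hΨ h1 h2 fun x hx _ => hin x hx
  have hκ : κ = 0 := S.jump_eq_zero (hin _ hc)
  have hW := S.memW11 hab.le (Or.inl hκ)
  have hderiv_a : Ψ a = 1 → Tendsto (deriv (primitiveWithJump (slope a b Ψ) ((a + b) / 2) K κ))
      (𝓝[>] a) atTop := by
    refine S.tendsto_deriv_atTop nhdsWithin_le_nhds ?_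
    filter_upwards [Ioo_mem_nhdsGT hc.1] with x hx
    exact ⟨⟨hx.1, hx.2.trans hc.2⟩, hx.2.ne⟩
  have hderiv_b : Ψ b = -1 → Tendsto (deriv (primitiveWithJump (slope a b Ψ) ((a + b) / 2) K κ))
      (𝓝[<] b) atBot := by
    refine S.tendsto_deriv_atBot nhdsWithin_le_nhds ?_
    filter_upwards [Ioo_mem_nhdsLT hc.2] with x hx
    exact ⟨⟨hc.1.trans hx.1, hx.2⟩, hx.1.ne'⟩
  have ha1 := abs_le.1 (S.abs_le a (left_mem_Icc.2 hab.le))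
  have hb1 := abs_le.1 (S.abs_le b (right_mem_Icc.2 hab.le))
  refine ⟨_, S.ae_eq, S.concaveOn subset_rfl hin hm, ?_, S.satisfiesEqAE⟩
  -- A decreasing flux can reach 1 only at a and -1 only at b; the four alternatives record which of
  -- these happens.
  by_cases hA : Ψ a < 1 <;> by_cases hB : -1 < Ψ b
  · exact Or.inl (S.memW21 hab.le le_rfl le_rfl (Or.inl hκ) fun x hx =>
      abs_lt.2 ⟨lower x hx.1 hx.2 (Or.inr hB), upper x hx.1 hx.2 (Or.inr hA)⟩)
  · refine Or.inr (Or.inl ⟨fun d had hdb => S.memW21 had.le le_rfl hdb.le (Or.inl hκ) fun x hx =>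
      abs_lt.2 ⟨lower x hx.1 (hx.2.trans hdb.le) (Or.inl (hx.2.trans_lt hdb).ne),
        upper x hx.1 (hx.2.trans hdb.le) (Or.inr hA)⟩, hW,
      hderiv_b ?_⟩)
    linarith
  · refine Or.inr (Or.inr (Or.inl ⟨fun d had hdb => S.memW21 hdb.le had.le le_rfl (Or.inl hκ)
      fun x hx => abs_lt.2 ⟨lower x (had.le.trans hx.1) hx.2 (Or.inr hB),
        upper x (had.le.trans hx.1) hx.2 (Or.inl (had.trans_le hx.1).ne')⟩, hW,
      hderiv_a ?_⟩))
    linarith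
  · refine Or.inr (Or.inr (Or.inr ⟨fun s t has hst htb => S.memW21 hst.le has.le htb.le (Or.inl hκ)
      fun x hx => hin x ⟨has.trans_le hx.1, hx.2.trans_lt htb⟩, hW, hderiv_a ?_, hderiv_b ?_⟩)) <;>
    linarith

theorem IsBVSolution.exists_convex {f : ℝ → ℝ → ℝ} {a b : ℝ} {u : ℝ → ℝ} (hab : a < b)
    (hu : IsBVSolution f a b u) (hf : ∀ᵐ x ∂(volume.restrict (Ioo a b)), f x (u x) ≤ 0) :
    ∃ v : ℝ → ℝ, v =ᵐ[volume.restrict (Ioo a b)] u ∧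
      ConvexOn ℝ (Ioo a b) v ∧
      (MemW21 a b v ∨
        (MemW21locCO a b v ∧ MemW11 a b v ∧ Tendsto (deriv v) (𝓝[<] b) atTop) ∨
        (MemW21locOC a b v ∧ MemW11 a b v ∧ Tendsto (deriv v) (𝓝[>] a) atBot) ∨
        (MemW21locOO a b v ∧ MemW11 a b v ∧
          Tendsto (deriv v) (𝓝[>] a) atBot ∧ Tendsto (deriv v) (𝓝[<] b) atTop)) ∧
      SatisfiesEqAE f a b v := by
  obtain ⟨μ, Ψ, hμ, hΨ, h1, h2⟩ := hu.exists_isFluxOf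
  have hlt : ∀ᵐ x ∂(volume.restrict (Ioo a b)), |Ψ x| < 1 := by
    filter_upwards [h1] with x hx
    rw [← hx]; exact abs_div_sqrt_one_add_sq_lt _
  have hm : MonotoneOn Ψ (Icc a b) := hΨ.monotoneOn (by
    filter_upwards [hf, ae_restrict_mem measurableSet_Ioo] with x hx hxI
    rwa [indicator_of_mem hxI])
  have upper : ∀ x, a ≤ x → x ≤ b → (x ≠ b ∨ Ψ b < 1) → Ψ x < 1 := fun x hax hxb h => by
    rcases hxb.eq_or_lt with rfl | hxb
    · simpa using h
    · exact lt_one_of_monotoneOn hm le_rfl le_rfl hlt hax hxb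
  have lower : ∀ x, a ≤ x → x ≤ b → (x ≠ a ∨ -1 < Ψ a) → -1 < Ψ x := fun x hax hxb h => by
    rcases hax.eq_or_lt with rfl | hax
    · simpa using h
    · exact neg_one_lt_of_monotoneOn hm le_rfl le_rfl hlt hax hxb
  have hin : ∀ x ∈ Ioo a b, |Ψ x| < 1 := fun x hx =>
    abs_lt.2 ⟨lower x hx.1.le hx.2.le (Or.inl hx.1.ne'),
      upper x hx.1.le hx.2.le (Or.inl hx.2.ne)⟩
  have hc : (a + b) / 2 ∈ Ioo a b := ⟨by linarith, by linarith⟩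
  obtain ⟨K, κ, S⟩ := exists_isFluxSolution hc hμ hΨ h1 h2 fun x hx _ => hin x hx
  have hκ : κ = 0 := S.jump_eq_zero (hin _ hc)
  have hW := S.memW11 hab.le (Or.inl hκ)
  have hderiv_a : Ψ a = -1 → Tendsto (deriv (primitiveWithJump (slope a b Ψ) ((a + b) / 2) K κ))
      (𝓝[>] a) atBot := by
    refine S.tendsto_deriv_atBot nhdsWithin_le_nhds ?_
    filter_upwards [Ioo_mem_nhdsGT hc.1] with x hx
    exact ⟨⟨hx.1, hx.2.trans hc.2⟩, hx.2.ne⟩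
  have hderiv_b : Ψ b = 1 → Tendsto (deriv (primitiveWithJump (slope a b Ψ) ((a + b) / 2) K κ))
      (𝓝[<] b) atTop := by
    refine S.tendsto_deriv_atTop nhdsWithin_le_nhds ?_
    filter_upwards [Ioo_mem_nhdsLT hc.2] with x hx
    exact ⟨⟨hc.1.trans hx.1, hx.2⟩, hx.1.ne'⟩
  have ha1 := abs_le.1 (S.abs_le a (left_mem_Icc.2 hab.le))
  have hb1 := abs_le.1 (S.abs_le b (right_mem_Icc.2 hab.le))
  refine ⟨_, S.ae_eq, S.convexOn subset_rfl hin hm, ?_, S.satisfiesEqAE⟩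
  -- For an increasing flux the degenerate values are -1 at a and 1 at b.
  by_cases hA : -1 < Ψ a <;> by_cases hB : Ψ b < 1
  · exact Or.inl (S.memW21 hab.le le_rfl le_rfl (Or.inl hκ) fun x hx =>
      abs_lt.2 ⟨lower x hx.1 hx.2 (Or.inr hA), upper x hx.1 hx.2 (Or.inr hB)⟩)
  · refine Or.inr (Or.inl ⟨fun d had hdb => S.memW21 had.le le_rfl hdb.le (Or.inl hκ) fun x hx =>
      abs_lt.2 ⟨lower x hx.1 (hx.2.trans hdb.le) (Or.inr hA),
        upper x hx.1 (hx.2.trans hdb.le) (Or.inl (hx.2.trans_lt hdb).ne)⟩, hW,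
      hderiv_b ?_⟩)
    linarith
  · refine Or.inr (Or.inr (Or.inl ⟨fun d had hdb => S.memW21 hdb.le had.le le_rfl (Or.inl hκ)
      fun x hx => abs_lt.2 ⟨lower x (had.le.trans hx.1) hx.2 (Or.inl (had.trans_le hx.1).ne'),
        upper x (had.le.trans hx.1) hx.2 (Or.inr hB)⟩, hW,
      hderiv_a ?_⟩))
    linarith
  · refine Or.inr (Or.inr (Or.inr ⟨fun s t has hst htb => S.memW21 hst.le has.le htb.le (Or.inl hκ)
      fun x hx => hin x ⟨has.trans_le hx.1, hx.2.trans_lt htb⟩, hW, hderiv_a ?_, hderiv_b ?_⟩)) <;>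
    linarith

/-- The flux decreases up to c and increases afterwards, so in (a, b) it can only degenerate at its
minimum point c, with value -1. -/
theorem IsBVSolution.exists_concave_convex {f : ℝ → ℝ → ℝ} {a b c : ℝ} {u : ℝ → ℝ}
    (hu : IsBVSolution f a b u) (hc : c ∈ Ioo a b)
    (hf1 : ∀ᵐ x ∂(volume.restrict (Ioo a c)), 0 ≤ f x (u x))
    (hf2 : ∀ᵐ x ∂(volume.restrict (Ioo c b)), f x (u x) ≤ 0) :
    ∃ v : ℝ → ℝ, v =ᵐ[volume.restrict (Ioo a b)] u ∧
      ConcaveOn ℝ (Ioo a c) v ∧ ConvexOn ℝ (Ioo c b) v ∧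
      (∃ Lm Lp : ℝ, HasLeftTrace v c Lm ∧ HasRightTrace v c Lp ∧
        ((MemW21locOO a b v ∧ MemW11 a b v) ∨
          (MemW21locOO a c v ∧ MemW11 a c v ∧ MemW21locOO c b v ∧ MemW11 c b v ∧
            Lp ≤ Lm ∧
            Tendsto (deriv v) (𝓝[<] c) atBot ∧ Tendsto (deriv v) (𝓝[>] c) atBot)) ∧
        (Lp < Lm → SingPartIsJump a b v c Lm Lp)) ∧
      SatisfiesEqAE f a b v := by
  obtain ⟨μ, Ψ, hμ, hΨ, h1, h2⟩ := hu.exists_isFluxOf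
  have hlt : ∀ᵐ x ∂(volume.restrict (Ioo a b)), |Ψ x| < 1 := by
    filter_upwards [h1] with x hx
    rw [← hx]; exact abs_div_sqrt_one_add_sq_lt _
  have hm1 : AntitoneOn Ψ (Icc a c) := hΨ.antitoneOn (by
    filter_upwards [hf1, ae_restrict_mem measurableSet_Ioo] with x hx hxI
    rwa [indicator_of_mem (Ioo_subset_Ioo_right hc.2.le hxI)])
  have hm2 : MonotoneOn Ψ (Icc c b) := hΨ.monotoneOn (by
    filter_upwards [hf2, ae_restrict_mem measurableSet_Ioo] with x hx hxI
    rwa [indicator_of_mem (Ioo_subset_Ioo_left hc.1.le hxI)])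
  have hin1 : ∀ x ∈ Ioo a c, |Ψ x| < 1 := fun x hx => abs_lt.2
    ⟨neg_one_lt_of_antitoneOn hm1 le_rfl hc.2.le hlt hx.1.le hx.2,
      lt_one_of_antitoneOn hm1 le_rfl hc.2.le hlt hx.1 hx.2.le⟩
  have hin2 : ∀ x ∈ Ioo c b, |Ψ x| < 1 := fun x hx => abs_lt.2
    ⟨neg_one_lt_of_monotoneOn hm2 hc.1.le le_rfl hlt hx.1 hx.2.le,
      lt_one_of_monotoneOn hm2 hc.1.le le_rfl hlt hx.1.le hx.2⟩
  have hne : ∀ x ∈ Ioo a b, x ≠ c → |Ψ x| < 1 := fun x hx hxc =>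
    hxc.lt_or_gt.elim (fun h => hin1 x ⟨hx.1, h⟩) fun h => hin2 x ⟨h, hx.2⟩
  have hside : Ψ c < 1 :=
    lt_one_of_antitoneOn hm1 le_rfl hc.2.le hlt hc.1 le_rfl
  obtain ⟨K, κ, S⟩ := exists_isFluxSolution hc hμ hΨ h1 h2 hne
  refine ⟨_, S.ae_eq, S.concaveOn (Ioo_subset_Ioo_right hc.2.le) hin1 hm1,
    S.convexOn (Ioo_subset_Ioo_left hc.1.le) hin2 hm2,
    ⟨K, K + κ, S.hasLeftTrace, S.hasRightTrace, ?_, fun _ => S.singPartIsJump⟩, S.satisfiesEqAE⟩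
  by_cases hC : -1 < Ψ c
  · have hcc : |Ψ c| < 1 := abs_lt.2 ⟨hC, hside⟩
    have hin : ∀ x ∈ Ioo a b, |Ψ x| < 1 := fun x hx => by
      rcases eq_or_ne x c with rfl | h
      exacts [hcc, hne x hx h]
    have hκ := S.jump_eq_zero hcc
    exact Or.inl ⟨fun s t has hst htb => S.memW21 hst.le has.le htb.le (Or.inl hκ)
      fun x hx => hin x ⟨has.trans_le hx.1, hx.2.trans_lt htb⟩,
      S.memW11 (hc.1.trans hc.2).le (Or.inl hκ)⟩
  · have hc1 := abs_le.1 (S.abs_le c (Ioo_subset_Icc_self hc))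
    have hval : Ψ c = -1 := by linarith
    refine Or.inr ⟨fun s t has hst htc => S.memW21 hst.le has.le (htc.trans hc.2).le
      (Or.inr (Or.inl htc.le)) fun x hx => hin1 x ⟨has.trans_le hx.1, hx.2.trans_lt htc⟩,
      S.memW11 hc.1.le (Or.inr (Or.inl le_rfl)),
      fun s t hcs hst htb => S.memW21 hst.le (hc.1.trans hcs).le htb.le
        (Or.inr (Or.inr hcs.le)) fun x hx => hin2 x ⟨hcs.trans_le hx.1, hx.2.trans_lt htb⟩,
      S.memW11 hc.2.le (Or.inr (Or.inr le_rfl)), ?_,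
      S.tendsto_deriv_atBot nhdsWithin_le_nhds ?_ hval,
      S.tendsto_deriv_atBot nhdsWithin_le_nhds ?_ hval⟩
    -- The jump is r Ψ(c) = -r ≤ 0.
    · obtain ⟨r, hr, -, hκ⟩ := S.jump
      rw [hval] at hκ
      linarith
    · filter_upwards [Ioo_mem_nhdsLT hc.1] with x hx
      exact ⟨⟨hx.1, hx.2.trans hc.2⟩, hx.2.ne⟩
    · filter_upwards [Ioo_mem_nhdsGT hc.2] with x hx
      exact ⟨⟨hc.1.trans hx.1, hx.2⟩, hx.1.ne'⟩

/-- Now c is the maximum point of the flux, the only possible degenerate value is 1, and a jump goes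
upwards. -/
theorem IsBVSolution.exists_convex_concave {f : ℝ → ℝ → ℝ} {a b c : ℝ} {u : ℝ → ℝ}
    (hu : IsBVSolution f a b u) (hc : c ∈ Ioo a b)
    (hf1 : ∀ᵐ x ∂(volume.restrict (Ioo a c)), f x (u x) ≤ 0)
    (hf2 : ∀ᵐ x ∂(volume.restrict (Ioo c b)), 0 ≤ f x (u x)) :
    ∃ v : ℝ → ℝ, v =ᵐ[volume.restrict (Ioo a b)] u ∧
      ConvexOn ℝ (Ioo a c) v ∧ ConcaveOn ℝ (Ioo c b) v ∧
      (∃ Lm Lp : ℝ, HasLeftTrace v c Lm ∧ HasRightTrace v c Lp ∧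
        ((MemW21locOO a b v ∧ MemW11 a b v) ∨
          (MemW21locOO a c v ∧ MemW11 a c v ∧ MemW21locOO c b v ∧ MemW11 c b v ∧
            Lm ≤ Lp ∧
            Tendsto (deriv v) (𝓝[<] c) atTop ∧ Tendsto (deriv v) (𝓝[>] c) atTop)) ∧
        (Lm < Lp → SingPartIsJump a b v c Lm Lp)) ∧
      SatisfiesEqAE f a b v := by
  obtain ⟨μ, Ψ, hμ, hΨ, h1, h2⟩ := hu.exists_isFluxOf
  have hlt : ∀ᵐ x ∂(volume.restrict (Ioo a b)), |Ψ x| < 1 := by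
    filter_upwards [h1] with x hx
    rw [← hx]; exact abs_div_sqrt_one_add_sq_lt _
  have hm1 : MonotoneOn Ψ (Icc a c) := hΨ.monotoneOn (by
    filter_upwards [hf1, ae_restrict_mem measurableSet_Ioo] with x hx hxI
    rwa [indicator_of_mem (Ioo_subset_Ioo_right hc.2.le hxI)])
  have hm2 : AntitoneOn Ψ (Icc c b) := hΨ.antitoneOn (by
    filter_upwards [hf2, ae_restrict_mem measurableSet_Ioo] with x hx hxI
    rwa [indicator_of_mem (Ioo_subset_Ioo_left hc.1.le hxI)])
  have hin1 : ∀ x ∈ Ioo a c, |Ψ x| < 1 := fun x hx => abs_lt.2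
    ⟨neg_one_lt_of_monotoneOn hm1 le_rfl hc.2.le hlt hx.1 hx.2.le,
      lt_one_of_monotoneOn hm1 le_rfl hc.2.le hlt hx.1.le hx.2⟩
  have hin2 : ∀ x ∈ Ioo c b, |Ψ x| < 1 := fun x hx => abs_lt.2
    ⟨neg_one_lt_of_antitoneOn hm2 hc.1.le le_rfl hlt hx.1.le hx.2,
      lt_one_of_antitoneOn hm2 hc.1.le le_rfl hlt hx.1 hx.2.le⟩
  have hne : ∀ x ∈ Ioo a b, x ≠ c → |Ψ x| < 1 := fun x hx hxc =>
    hxc.lt_or_gt.elim (fun h => hin1 x ⟨hx.1, h⟩) fun h => hin2 x ⟨h, hx.2⟩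
  have hside : -1 < Ψ c :=
    neg_one_lt_of_monotoneOn hm1 le_rfl hc.2.le hlt hc.1 le_rfl
  obtain ⟨K, κ, S⟩ := exists_isFluxSolution hc hμ hΨ h1 h2 hne
  refine ⟨_, S.ae_eq, S.convexOn (Ioo_subset_Ioo_right hc.2.le) hin1 hm1,
    S.concaveOn (Ioo_subset_Ioo_left hc.1.le) hin2 hm2,
    ⟨K, K + κ, S.hasLeftTrace, S.hasRightTrace, ?_, fun _ => S.singPartIsJump⟩, S.satisfiesEqAE⟩
  by_cases hC : Ψ c < 1
  · have hcc : |Ψ c| < 1 := abs_lt.2 ⟨hside, hC⟩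
    have hin : ∀ x ∈ Ioo a b, |Ψ x| < 1 := fun x hx => by
      rcases eq_or_ne x c with rfl | h
      exacts [hcc, hne x hx h]
    have hκ := S.jump_eq_zero hcc
    exact Or.inl ⟨fun s t has hst htb => S.memW21 hst.le has.le htb.le (Or.inl hκ)
      fun x hx => hin x ⟨has.trans_le hx.1, hx.2.trans_lt htb⟩,
      S.memW11 (hc.1.trans hc.2).le (Or.inl hκ)⟩
  · have hc1 := abs_le.1 (S.abs_le c (Ioo_subset_Icc_self hc))
    have hval : Ψ c = 1 := by linarith
    refine Or.inr ⟨fun s t has hst htc => S.memW21 hst.le has.le (htc.trans hc.2).le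
      (Or.inr (Or.inl htc.le)) fun x hx => hin1 x ⟨has.trans_le hx.1, hx.2.trans_lt htc⟩,
      S.memW11 hc.1.le (Or.inr (Or.inl le_rfl)),
      fun s t hcs hst htb => S.memW21 hst.le (hc.1.trans hcs).le htb.le
        (Or.inr (Or.inr hcs.le)) fun x hx => hin2 x ⟨hcs.trans_le hx.1, hx.2.trans_lt htb⟩,
      S.memW11 hc.2.le (Or.inr (Or.inr le_rfl)), ?_,
      S.tendsto_deriv_atTop nhdsWithin_le_nhds ?_ hval,
      S.tendsto_deriv_atTop nhdsWithin_le_nhds ?_ hval⟩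
    · obtain ⟨r, hr, -, hκ⟩ := S.jump
      rw [hval] at hκ
      linarith
    · filter_upwards [Ioo_mem_nhdsLT hc.1] with x hx
      exact ⟨⟨hx.1, hx.2.trans hc.2⟩, hx.2.ne⟩
    · filter_upwards [Ioo_mem_nhdsGT hc.2] with x hx
      exact ⟨⟨hc.1.trans hx.1, hx.2⟩, hx.1.ne'⟩

end Curvature

end

open Curvature in
/-- As usual, `u` is identified with its representatives: `v` is the representative of `u` to which
the pointwise assertions (concavity, convexity, behaviour of the derivative) refer. -/
theorem theorem3p1 (a b : ℝ) (hab : a < b) (f : ℝ → ℝ → ℝ) (u : ℝ → ℝ)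
    (hu : IsBVSolution f a b u) :
    -- (i)
    ((∀ᵐ x ∂(volume.restrict (Ioo a b)), 0 ≤ f x (u x)) →
      ∃ v : ℝ → ℝ, v =ᵐ[volume.restrict (Ioo a b)] u ∧
        ConcaveOn ℝ (Ioo a b) v ∧
        (MemW21 a b v ∨
          (MemW21locCO a b v ∧ MemW11 a b v ∧ Tendsto (deriv v) (𝓝[<] b) atBot) ∨
          (MemW21locOC a b v ∧ MemW11 a b v ∧ Tendsto (deriv v) (𝓝[>] a) atTop) ∨
          (MemW21locOO a b v ∧ MemW11 a b v ∧
            Tendsto (deriv v) (𝓝[>] a) atTop ∧ Tendsto (deriv v) (𝓝[<] b) atBot)) ∧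
        SatisfiesEqAE f a b v) ∧
    -- (ii)
    ((∀ᵐ x ∂(volume.restrict (Ioo a b)), f x (u x) ≤ 0) →
      ∃ v : ℝ → ℝ, v =ᵐ[volume.restrict (Ioo a b)] u ∧
        ConvexOn ℝ (Ioo a b) v ∧
        (MemW21 a b v ∨
          (MemW21locCO a b v ∧ MemW11 a b v ∧ Tendsto (deriv v) (𝓝[<] b) atTop) ∨
          (MemW21locOC a b v ∧ MemW11 a b v ∧ Tendsto (deriv v) (𝓝[>] a) atBot) ∨
          (MemW21locOO a b v ∧ MemW11 a b v ∧
            Tendsto (deriv v) (𝓝[>] a) atBot ∧ Tendsto (deriv v) (𝓝[<] b) atTop)) ∧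
        SatisfiesEqAE f a b v) ∧
    -- (iii)
    (∀ c ∈ Ioo a b,
      (∀ᵐ x ∂(volume.restrict (Ioo a c)), 0 ≤ f x (u x)) →
      (∀ᵐ x ∂(volume.restrict (Ioo c b)), f x (u x) ≤ 0) →
      ∃ v : ℝ → ℝ, v =ᵐ[volume.restrict (Ioo a b)] u ∧
        ConcaveOn ℝ (Ioo a c) v ∧ ConvexOn ℝ (Ioo c b) v ∧
        (∃ Lm Lp : ℝ, HasLeftTrace v c Lm ∧ HasRightTrace v c Lp ∧
          ((MemW21locOO a b v ∧ MemW11 a b v) ∨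
            (MemW21locOO a c v ∧ MemW11 a c v ∧ MemW21locOO c b v ∧ MemW11 c b v ∧
              Lp ≤ Lm ∧
              Tendsto (deriv v) (𝓝[<] c) atBot ∧ Tendsto (deriv v) (𝓝[>] c) atBot)) ∧
          (Lp < Lm → SingPartIsJump a b v c Lm Lp)) ∧
        SatisfiesEqAE f a b v) ∧
    -- (iiii)
    (∀ c ∈ Ioo a b,
      (∀ᵐ x ∂(volume.restrict (Ioo a c)), f x (u x) ≤ 0) →
      (∀ᵐ x ∂(volume.restrict (Ioo c b)), 0 ≤ f x (u x)) →
      ∃ v : ℝ → ℝ, v =ᵐ[volume.restrict (Ioo a b)] u ∧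
        ConvexOn ℝ (Ioo a c) v ∧ ConcaveOn ℝ (Ioo c b) v ∧
        (∃ Lm Lp : ℝ, HasLeftTrace v c Lm ∧ HasRightTrace v c Lp ∧
          ((MemW21locOO a b v ∧ MemW11 a b v) ∨
            (MemW21locOO a c v ∧ MemW11 a c v ∧ MemW21locOO c b v ∧ MemW11 c b v ∧
              Lm ≤ Lp ∧
              Tendsto (deriv v) (𝓝[<] c) atTop ∧ Tendsto (deriv v) (𝓝[>] c) atTop)) ∧
          (Lm < Lp → SingPartIsJump a b v c Lm Lp)) ∧
        SatisfiesEqAE f a b v) := by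
  exact ⟨hu.exists_concave hab, hu.exists_convex hab,
    fun _ hc => hu.exists_concave_convex hc, fun _ hc => hu.exists_convex_concave hc⟩
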